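/- Let $\mathcal X,\mathcal Y$ be finite nonempty alphabets and let $W=(W(y|x))$ be a row-stochastic matrix with all entries strictly positive. All logarithms are to base $2$. **Channel and codes.** In the noisy permutation channel of blocklength $n$, an input $x^n\in\mathcal X^n$ produces $Z^n$ with law $\prod_t W(z_t|x_t)$, and the output $Y^n$ is given by $Y_{\sigma(i)}=Z_i$, where $\sigma$ is an independent uniformly random permutation of $\{1,\dots,n\}$. A code with finite nonempty message set $\mathcal M$ is a pair of maps $f:\mathcal M\to\mathcal X^n$, $g:\mathcal Y^n\to\mathcal M\cup\{\mathtt e\}$; its average error probability is $P_e=\mathbb P[g(Y^n)\neq U]$ with $U$ uniform on $\mathcal M$ and $f(U)$ sent. For $\epsilon\in(0,1)$ let $M^\star(n,\epsilon)$ be the largest $|\mathcal M|$ over codes with $P_e\le\epsilon$, and let $C_\epsilon=\liminf_{n\to\infty}\log M^\star(n,\epsilon)/\log n$. **Geometry.** Let $\Delta(\mathcal X)$, $\Delta(\mathcal Y)$ be the probability simplices, $\mathcal P_W=\{pW:p\in\Delta(\mathcal X)\}\subseteq\mathbb R^{\mathcal Y}$, $A=\operatorname{aff}(\mathcal P_W)$,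 $d=\dim\mathcal P_W$ (affine dimension), $\mathcal R_W=A\cap\Delta(\mathcal Y)$. Let $\operatorname{vol}_d$ denote $d$-dimensional Euclidean volume and put $$\lambda_W^\star=\frac{\operatorname{vol}_d(\mathcal P_W)}{\inf_S\operatorname{vol}_d(S)},$$ the infimum being over all $d$-simplices $S$ with $\mathcal R_W\subseteq S\subseteq A$. Fix a minimum-volume simplex $S_W^\star$ among these, with vertices $s_0,\dots,s_d$. Let $T(u)=\sum_i u_is_i$ for $u\in\mathbb R^{d+1}$ with $\sum_i u_i=1$ (an affine bijection onto $A$), let $K_W=T^{-1}(\mathcal P_W)$, let $\Pi_A$ be the orthogonal projection onto $A$, and let $H=T^{-1}\circ\Pi_A$. **Gaussian coefficient.** With $b_y$ and $e_i$ the standard basis vectors of $\mathbb R^{\mathcal Y}$ and $\mathbb R^{d+1}$ and $\Phi$ the standard normal distribution function, let, for $u\in K_W$ and $i\neq j$ in $\{0,\dots,d\}$, $$V_{ij}(u)=\operatorname{Var}_{Y\sim T(u)}\langle H(b_Y)-u,\,e_i-e_j\rangle,$$ $$A_W(c)=\frac1{\operatorname{vol}_d(K_W)}\int_{K_W}\sum_{i\ne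 j}\Phi\Bigl(-\frac1{c\sqrt{V_{ij}(u)}}\Bigr)\,du\quad(c>0),\qquad c_\epsilon=\sup\{c>0:A_W(c)<\epsilon\}.$$ **Statement.** Assume $d\ge1$ and fix $\epsilon\in(0,1)$. 1. For every choice of $S_W^\star$ for which $0<c_\epsilon<\infty$ there is a constant $C$, depending only on $W$, $\epsilon$ and the fixed $S_W^\star$, such that for all sufficiently large $n$ $$\log M^\star(n,\epsilon)\le d\log(c_\epsilon\sqrt n)+\log\lambda_W^\star+C .$$ 2. The $\epsilon$-capacity is $C_\epsilon=d/2$, and $\operatorname{rank}W=d+1$; so $C_\epsilon=(\operatorname{rank}W-1)/2$, whatever $\epsilon\in(0,1)$. -/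

import Mathlib

open MeasureTheory

noncomputable section

namespace NoisyPerm

variable {X Y : Type*} [Fintype X] [Fintype Y]

/-! ### Codes over the noisy permutation channel -/

/-- A code of blocklength `n` with message set `Fin M`.  The decoder output `none` is the
error symbol. -/
structure Code (X Y : Type*) (n M : ℕ) where
  enc : Fin M → Fin n → X
  dec : (Fin n → Y) → Option (Fin M)

/-- Memoryless law of the noisy codeword `z` given the input codeword `x`. -/
def dmcLaw (W : Matrix X Y ℝ) {n : ℕ} (x : Fin n → X) (z : Fin n → Y) : ℝ :=
  ∏ t, W (x t) (z t)

/-- Law of the output of the uniform random permutation block: `y (σ i) = z i` for all `i`, with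
`σ` uniform on the symmetric group. -/
def shuffleLaw [DecidableEq Y] {n : ℕ} (z y : Fin n → Y) : ℝ :=
  (∑ σ : Equiv.Perm (Fin n), if ∀ i, y (σ i) = z i then (1 : ℝ) else 0) / (n.factorial : ℝ)

/-- Law of the output codeword `y` given the input codeword `x`. -/
def permLaw [DecidableEq Y] (W : Matrix X Y ℝ) {n : ℕ} (x : Fin n → X) (y : Fin n → Y) : ℝ :=
  ∑ z : Fin n → Y, dmcLaw W x z * shuffleLaw z y

/-- Average error probability, for a uniformly distributed message. -/
def errProb [DecidableEq Y] (W : Matrix X Y ℝ) {n M : ℕ} (C : Code X Y n M) : ℝ :=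
  (∑ u : Fin M, ∑ y : Fin n → Y, if C.dec y ≠ some u then permLaw W (C.enc u) y else 0) / (M : ℝ)

/-- Maximal number of messages at blocklength `n` and average error probability at most `ε`. -/
def maxMessages [DecidableEq Y] (W : Matrix X Y ℝ) (n : ℕ) (ε : ℝ) : ℕ :=
  sSup {M : ℕ | 0 < M ∧ ∃ C : Code X Y n M, errProb W C ≤ ε}

/-- The `ε`-capacity. -/
def epsCapacity [DecidableEq Y] (W : Matrix X Y ℝ) (ε : ℝ) : EReal :=
  Filter.liminf
    (fun n : ℕ => ((Real.logb 2 (maxMessages W n ε) / Real.logb 2 n : ℝ) : EReal)) Filter.atTop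

/-! ### Reachable output polytope -/

/-- The set of reachable output distributions `p W`. -/
def polytope (W : Matrix X Y ℝ) : Set (EuclideanSpace ℝ Y) :=
  {q | ∃ p ∈ stdSimplex ℝ X, q = WithLp.toLp 2 (Matrix.vecMul p W)}

/-- The affine hull of the reachable output polytope. -/
def hull (W : Matrix X Y ℝ) : AffineSubspace ℝ (EuclideanSpace ℝ Y) :=
  affineSpan ℝ (polytope W)

/-- The affine dimension of the reachable output polytope. -/
def affDim (W : Matrix X Y ℝ) : ℕ :=
  Module.finrank ℝ (hull W).direction

/-- The part of the output probability simplex lying in the affine hull. -/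
def slice (W : Matrix X Y ℝ) : Set (EuclideanSpace ℝ Y) :=
  {q | q ∈ hull W ∧ WithLp.ofLp q ∈ stdSimplex ℝ Y}

/-- The (solid) simplex spanned by the vertices `S.points`. -/
def solid {W : Matrix X Y ℝ} (S : Affine.Simplex ℝ (EuclideanSpace ℝ Y) (affDim W)) :
    Set (EuclideanSpace ℝ Y) :=
  convexHull ℝ (Set.range S.points)

/-- `S` is a `d`-simplex with `slice W ⊆ S ⊆ hull W`. -/
def IsReference (W : Matrix X Y ℝ) (S : Affine.Simplex ℝ (EuclideanSpace ℝ Y) (affDim W)) : Prop :=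
  slice W ⊆ solid S ∧ solid S ⊆ (hull W : Set (EuclideanSpace ℝ Y))

/-- `S` is a minimum-volume `d`-simplex with `slice W ⊆ S ⊆ hull W`. -/
def IsMinReference (W : Matrix X Y ℝ)
    (S : Affine.Simplex ℝ (EuclideanSpace ℝ Y) (affDim W)) : Prop :=
  IsReference W S ∧ ∀ S', IsReference W S' → μHE[affDim W] (solid S) ≤ μHE[affDim W] (solid S')

/-- Volume of the reachable polytope divided by the infimum of the volumes of the reference
simplices. -/
def volRatio (W : Matrix X Y ℝ) : ℝ :=
  (μHE[affDim W] (polytope W) /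
    ⨅ (S : Affine.Simplex ℝ (EuclideanSpace ℝ Y) (affDim W)) (_ : IsReference W S),
      μHE[affDim W] (solid S)).toReal

instance polytope_nonempty [Nonempty X] (W : Matrix X Y ℝ) : Nonempty (polytope W) := by
  classical
  obtain ⟨x⟩ := ‹Nonempty X›
  exact ⟨⟨_, Pi.single x 1, single_mem_stdSimplex ℝ x, rfl⟩⟩

instance hull_nonempty [Nonempty X] (W : Matrix X Y ℝ) : Nonempty (hull W) :=
  inferInstanceAs (Nonempty (affineSpan ℝ (polytope W)))

/-! ### Affine coordinates and the Gaussian coefficient -/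

section Gaussian

variable {W : Matrix X Y ℝ} (S : Affine.Simplex ℝ (EuclideanSpace ℝ Y) (affDim W))

/-- The hyperplane of affine coordinates. -/
def coordPlane (d : ℕ) : Set (EuclideanSpace ℝ (Fin (d + 1))) := {u | ∑ i, u i = 1}

/-- `T u = ∑ i, u i • s i`, where the `s i` are the vertices of `S`. -/
def coordMap (u : EuclideanSpace ℝ (Fin (affDim W + 1))) : EuclideanSpace ℝ Y :=
  ∑ i, u i • S.points i

/-- The preimage of the reachable polytope under `T`. -/
def coordPolytope : Set (EuclideanSpace ℝ (Fin (affDim W + 1))) :=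
  {u | u ∈ coordPlane (affDim W) ∧ coordMap S u ∈ polytope W}

/-- `H q = T⁻¹ (Π q)`, where `Π` is the Euclidean projection onto the affine hull and `T` is
restricted to the hyperplane of affine coordinates. -/
def coordProj [Nonempty X] (q : EuclideanSpace ℝ Y) : EuclideanSpace ℝ (Fin (affDim W + 1)) :=
  Function.invFunOn (coordMap S) (coordPlane (affDim W))
    (EuclideanGeometry.orthogonalProjection (hull W) q : EuclideanSpace ℝ Y)

/-- The transfer fluctuation `⟨H (b y) - u, e i - e j⟩`. -/
def transfer [Nonempty X] [DecidableEq Y] (i j : Fin (affDim W + 1))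
    (u : EuclideanSpace ℝ (Fin (affDim W + 1))) (y : Y) : ℝ :=
  inner ℝ (coordProj S (EuclideanSpace.single y 1) - u)
    (EuclideanSpace.single i 1 - EuclideanSpace.single j 1)

/-- The variance of the transfer fluctuation when `y` has law `T u`. -/
def transferVar [Nonempty X] [DecidableEq Y] (i j : Fin (affDim W + 1))
    (u : EuclideanSpace ℝ (Fin (affDim W + 1))) : ℝ :=
  ∑ y, coordMap S u y * (transfer S i j u y - ∑ y', coordMap S u y' * transfer S i j u y') ^ 2

/-- The average Gaussian union function. -/
def gaussianUnion [Nonempty X] [DecidableEq Y] (c : ℝ) : ℝ :=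
  (μHE[affDim W] (coordPolytope S)).toReal⁻¹ *
    ∫ u in coordPolytope S,
      (∑ ij : Fin (affDim W + 1) × Fin (affDim W + 1) with ij.1 ≠ ij.2,
        ProbabilityTheory.cdf (ProbabilityTheory.gaussianReal 0 1)
          (-(1 / (c * Real.sqrt (transferVar S ij.1 ij.2 u))))) ∂μHE[affDim W]

/-- The average Gaussian coefficient, as an extended nonnegative real. -/
def gaussianCoeff [Nonempty X] [DecidableEq Y] (ε : ℝ) : ENNReal :=
  ⨆ (c : ℝ) (_ : 0 < c ∧ gaussianUnion S c < ε), ENNReal.ofReal c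

end Gaussian

end NoisyPerm

end

noncomputable section

namespace NoisyPerm

/-! ### Expectations over the channel -/

section Channel

/-! Everything rests on the two-sided estimate `c * √n ^ d ≤ maxMessages W n ε ≤ K * √n ^ d` for
large `n`. The capacity follows on dividing logarithms by `log n`. In the first claim the additive
constant may depend on `W`, `ε` and `S`, so it absorbs the logarithms of `gaussianCoeff` and
`volRatio`.

Upper bound: after the shuffle all words with the same symbol counts are equally likely, so only the
counts carry information. With `k = |Y|`, Chebyshev confines them to within `O(√n)` of the mean
counts of some input. Those means obey the affine relations between the columns of `W`, so `d`
counts are free, one is fixed by the total `n`, and the other `k - 1 - d` range over `O(√n)` values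
(`card_nearCounts_le`). By Fourier inversion each count vector has probability `O(n ^ (-(k - 1) /
2))` under every input (`sum_dmcLaw_symbolCount_le`). Success needs mass spread over the reachable
counts, and number times probability is `O(√n ^ d)` (`card_mul_one_sub_errProb_le`).

Lower bound: `W` has `d + 1` independent rows. A code encodes by how often `d` of these letters
occur, in multiples of `D` of order `√n`, and pads with the remaining letter. Functions dual to the
rows estimate each multiplicity with error `O(√n)`, so about `√n` levels per letter can be told
apart (`exists_code_errProb_le`). -/

/-- The union bound for finite sums. -/
lemma sum_filter_exists_le {α ι : Type*} [Fintype α] [Fintype ι] (A : ι → α → Prop)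
    [∀ i, DecidablePred (A i)] [DecidablePred fun z => ∃ i, A i z] {f : α → ℝ}
    (hf : ∀ z, 0 ≤ f z) :
    ∑ z with ∃ i, A i z, f z ≤ ∑ i, ∑ z with A i z, f z := by
  simp only [Finset.sum_filter]
  rw [Finset.sum_comm]
  refine Finset.sum_le_sum fun z _ => ?_
  have hnn : ∀ i ∈ Finset.univ, 0 ≤ if A i z then f z else 0 := by
    intro i _
    split_ifs
    exacts [hf z, le_rfl]
  split_ifs with hz
  · obtain ⟨i, hi⟩ := hz
    refine le_trans ?_ (Finset.single_le_sum hnn (Finset.mem_univ i))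
    rw [if_pos hi]
  · exact Finset.sum_nonneg hnn

variable {X Y : Type*}

/-- The number of occurrences of each symbol in a word. -/
def symbolCount [DecidableEq Y] {n : ℕ} (z : Fin n → Y) (a : Y) : ℕ :=
  (Finset.univ.filter fun i => z i = a).card

lemma symbolCount_comp_perm [DecidableEq Y] {n : ℕ} (z : Fin n → Y) (σ : Equiv.Perm (Fin n)) :
    symbolCount (z ∘ σ) = symbolCount z := by
  funext a
  unfold symbolCount
  refine Finset.card_bij (fun i _ => σ i) (by simp) (by simp) ?_
  intro b hb
  exact ⟨σ.symm b, by simpa using hb, by simp⟩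

/-- Equal counts make the fibres over each symbol equinumerous; bijections of fibres glue to a
permutation of positions. -/
lemma exists_perm_of_symbolCount_eq [DecidableEq Y] {n : ℕ} {z z' : Fin n → Y}
    (h : symbolCount z = symbolCount z') : ∃ σ : Equiv.Perm (Fin n), z ∘ σ = z' := by
  have e : ∀ a, Nonempty ({i // z' i = a} ≃ {i // z i = a}) := by
    intro a
    refine ⟨Fintype.equivOfCardEq ?_⟩
    have := congrFun h a
    simp only [symbolCount] at this
    rw [Fintype.card_subtype, Fintype.card_subtype, this]
  refine ⟨(Equiv.sigmaFiberEquiv z').symm.trans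
    ((Equiv.sigmaCongrRight fun a => (e a).some).trans (Equiv.sigmaFiberEquiv z)), ?_⟩
  funext i
  exact ((e (z' i)).some ⟨i, rfl⟩).2

lemma dmcLaw_nonneg (W : Matrix X Y ℝ) (hW : ∀ x y, 0 ≤ W x y) {n : ℕ} (x : Fin n → X) (z : Fin n → Y) :
    0 ≤ dmcLaw W x z :=
  Finset.prod_nonneg fun _ _ => hW _ _

variable [Fintype Y]

lemma sum_symbolCount [DecidableEq Y] {n : ℕ} (z : Fin n → Y) : ∑ a, symbolCount z a = n := by
  have h := Finset.card_eq_sum_card_fiberwise (f := z) (s := Finset.univ) (t := Finset.univ)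
    (fun _ _ => Finset.mem_coe.2 (Finset.mem_univ _))
  simpa [symbolCount] using h.symm

lemma sum_comp_eq_sum_symbolCount [DecidableEq Y] {n : ℕ} (z : Fin n → Y) (f : Y → ℝ) :
    ∑ t, f (z t) = ∑ a, (symbolCount z a : ℝ) * f a := by
  rw [← Finset.sum_fiberwise Finset.univ z (fun t => f (z t))]
  refine Finset.sum_congr rfl fun a _ => ?_
  rw [Finset.sum_congr rfl (g := fun _ => f a)
    (fun t ht => by rw [(Finset.mem_filter.1 ht).2])]
  simp [symbolCount]

variable (W : Matrix X Y ℝ)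

lemma sum_dmcLaw_mul_prod {n : ℕ} (x : Fin n → X) (f : Fin n → Y → ℝ) :
    ∑ z, dmcLaw W x z * ∏ t, f t (z t) = ∏ t, ∑ y, W (x t) y * f t y := by
  classical
  rw [Finset.prod_univ_sum, Fintype.piFinset_univ]
  simp only [dmcLaw, Finset.prod_mul_distrib]

lemma sum_dmcLaw (hsum : ∀ x, ∑ y, W x y = 1) {n : ℕ} (x : Fin n → X) :
    ∑ z, dmcLaw W x z = 1 := by
  simpa [hsum] using sum_dmcLaw_mul_prod W x (fun _ _ => 1)

/-- For fixed `σ` the only noisy word that is shuffled to `y` is `y ∘ σ`, which collapses the sum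
over `z`. -/
lemma permLaw_eq [DecidableEq Y] {n : ℕ} (x : Fin n → X) (y : Fin n → Y) :
    permLaw W x y =
      (∑ σ : Equiv.Perm (Fin n), dmcLaw W x (y ∘ σ)) / (n.factorial : ℝ) := by
  have h : ∀ (σ : Equiv.Perm (Fin n)) (z : Fin n → Y), (∀ i, y (σ i) = z i) ↔ y ∘ σ = z :=
    fun σ z => ⟨fun h => funext h, fun h i => congrFun h i⟩
  simp only [permLaw, shuffleLaw, mul_div_assoc', ← Finset.sum_div, Finset.mul_sum, h]
  rw [Finset.sum_comm]
  simp

lemma permLaw_nonneg [DecidableEq Y] (hW : ∀ x y, 0 ≤ W x y) {n : ℕ} (x : Fin n → X)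
    (y : Fin n → Y) : 0 ≤ permLaw W x y := by
  rw [permLaw_eq]
  exact div_nonneg (Finset.sum_nonneg fun _ _ => dmcLaw_nonneg W hW _ _) (Nat.cast_nonneg _)

lemma permLaw_comp_perm [DecidableEq Y] {n : ℕ} (x : Fin n → X) (y : Fin n → Y)
    (τ : Equiv.Perm (Fin n)) : permLaw W x (y ∘ τ) = permLaw W x y := by
  rw [permLaw_eq, permLaw_eq]
  congr 1
  exact Fintype.sum_equiv (Equiv.mulLeft τ) _ _ (fun σ => rfl)

/-- Shuffling does not change the expectation of a permutation-invariant statistic. -/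
lemma sum_permLaw_mul [DecidableEq Y] {n : ℕ} (x : Fin n → X) (h : (Fin n → Y) → ℝ)
    (hh : ∀ (y : Fin n → Y) (σ : Equiv.Perm (Fin n)), h (y ∘ σ) = h y) :
    ∑ y, permLaw W x y * h y = ∑ z, dmcLaw W x z * h z := by
  simp only [permLaw_eq, div_mul_eq_mul_div, ← Finset.sum_div, Finset.sum_mul]
  rw [Finset.sum_comm]
  have : ∀ σ : Equiv.Perm (Fin n), ∑ y : Fin n → Y, dmcLaw W x (y ∘ σ) * h y
      = ∑ z, dmcLaw W x z * h z := by
    intro σ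
    refine Fintype.sum_equiv (Equiv.arrowCongr σ.symm (Equiv.refl Y)) _ _ fun y => ?_
    have : Equiv.arrowCongr σ.symm (Equiv.refl Y) y = y ∘ σ := by
      funext i; simp [Equiv.arrowCongr]
    rw [this, hh]
  simp only [this, Finset.sum_const, Finset.card_univ, Fintype.card_perm, Fintype.card_fin,
    nsmul_eq_mul]
  have : (n.factorial : ℝ) ≠ 0 := Nat.cast_ne_zero.2 n.factorial_ne_zero
  field_simp

lemma sum_permLaw [DecidableEq Y] (hsum : ∀ x, ∑ y, W x y = 1) {n : ℕ} (x : Fin n → X) :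
    ∑ y, permLaw W x y = 1 := by
  simpa [sum_dmcLaw W hsum] using sum_permLaw_mul W x (fun _ => 1) (fun _ _ => rfl)

/-- Independent centred summands are orthogonal. -/
lemma sum_dmcLaw_mul_sq (hsum : ∀ x, ∑ y, W x y = 1) {n : ℕ} (x : Fin n → X)
    (f : Fin n → Y → ℝ) (hf : ∀ t, ∑ y, W (x t) y * f t y = 0) :
    ∑ z, dmcLaw W x z * (∑ t, f t (z t)) ^ 2 = ∑ t, ∑ y, W (x t) y * f t y ^ 2 := by
  have key : ∀ s t, ∑ z, dmcLaw W x z * (f s (z s) * f t (z t)) =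
      if s = t then ∑ y, W (x s) y * f s y ^ 2 else 0 := by
    intro s t
    -- The product has factor `f s` at position `s`, `f t` at `t` and `1` elsewhere; for `s = t` the
    -- two factors multiply to the square.
    have h := sum_dmcLaw_mul_prod W x
      (fun r y => (if r = s then f r y else 1) * (if r = t then f r y else 1))
    simp only [Finset.prod_mul_distrib, Finset.prod_ite_eq', Finset.mem_univ, if_true] at h
    rw [h]
    split_ifs with hst
    · subst hst
      rw [Finset.prod_eq_single s]
      · simp [pow_two]
      · intro r _ hr
        simp [hr, hsum]
      · simp
    · refine Finset.prod_eq_zero (Finset.mem_univ s) ?_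
      simpa [hst] using hf s
  calc ∑ z, dmcLaw W x z * (∑ t, f t (z t)) ^ 2
      = ∑ z, ∑ s, ∑ t, dmcLaw W x z * (f s (z s) * f t (z t)) := by
        refine Finset.sum_congr rfl fun z _ => ?_
        rw [pow_two, Finset.sum_mul_sum, Finset.mul_sum]
        exact Finset.sum_congr rfl fun s _ => Finset.mul_sum _ _ _
    _ = ∑ s, ∑ t, ∑ z, dmcLaw W x z * (f s (z s) * f t (z t)) := by
        rw [Finset.sum_comm]
        exact Finset.sum_congr rfl fun s _ => Finset.sum_comm
    _ = _ := by simp [key]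

/-- Chebyshev's inequality for an additive statistic of the channel output. -/
lemma chebyshev_dmcLaw (hW : ∀ x y, 0 ≤ W x y) (hsum : ∀ x, ∑ y, W x y = 1) {n : ℕ}
    (x : Fin n → X) (g : Y → ℝ) {G R : ℝ} (hg : ∀ y, |g y| ≤ G) (hR : 0 < R) :
    ∑ z with R ≤ |∑ t, g (z t) - ∑ t, ∑ y, W (x t) y * g y|, dmcLaw W x z
      ≤ n * (2 * G) ^ 2 / R ^ 2 := by
  set m : Fin n → ℝ := fun t => ∑ y, W (x t) y * g y with hm
  have hmG : ∀ t, |m t| ≤ G := by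
    intro t
    calc |m t| ≤ ∑ y, |W (x t) y * g y| := Finset.abs_sum_le_sum_abs _ _
      _ ≤ ∑ y, W (x t) y * G := by
        refine Finset.sum_le_sum fun y _ => ?_
        rw [abs_mul, abs_of_nonneg (hW _ _)]
        exact mul_le_mul_of_nonneg_left (hg y) (hW _ _)
      _ = G := by rw [← Finset.sum_mul, hsum, one_mul]
  have h2 := sum_dmcLaw_mul_sq W hsum x (fun t y => g y - m t) (by
    intro t
    simp only [mul_sub, Finset.sum_sub_distrib, ← Finset.sum_mul, hsum, one_mul]
    simp [hm])
  have h3 : ∑ t, ∑ y, W (x t) y * (g y - m t) ^ 2 ≤ n * (2 * G) ^ 2 := by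
    have : ∀ t ∈ Finset.univ, ∑ y, W (x t) y * (g y - m t) ^ 2 ≤ (2 * G) ^ 2 := by
      intro t _
      calc ∑ y, W (x t) y * (g y - m t) ^ 2 ≤ ∑ y, W (x t) y * (2 * G) ^ 2 := by
            refine Finset.sum_le_sum fun y _ => mul_le_mul_of_nonneg_left ?_ (hW _ _)
            refine sq_le_sq' ?_ ?_ <;>
            · have := abs_le.1 (hg y); have := abs_le.1 (hmG t); linarith
        _ = _ := by rw [← Finset.sum_mul, hsum, one_mul]
    simpa using Finset.sum_le_sum this
  rw [le_div_iff₀ (by positivity), Finset.sum_mul]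
  calc _ ≤ ∑ z with R ≤ |∑ t, g (z t) - ∑ t, m t|, dmcLaw W x z * (∑ t, (g (z t) - m t)) ^ 2 := by
        refine Finset.sum_le_sum fun z hz => mul_le_mul_of_nonneg_left ?_ (dmcLaw_nonneg W hW _ _)
        rw [Finset.sum_sub_distrib, ← sq_abs (_ - _)]
        exact pow_le_pow_left₀ hR.le (Finset.mem_filter.1 hz).2 2
    _ ≤ ∑ z, dmcLaw W x z * (∑ t, (g (z t) - m t)) ^ 2 :=
        Finset.sum_le_sum_of_subset_of_nonneg (Finset.filter_subset _ _)
          fun z _ _ => mul_nonneg (dmcLaw_nonneg W hW _ _) (sq_nonneg _)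
    _ ≤ _ := h2.trans_le h3

/-- All words with the same symbol counts are equally likely after shuffling. -/
lemma card_mul_permLaw [DecidableEq Y] {n : ℕ} (x : Fin n → X) (y : Fin n → Y) :
    ((Finset.univ.filter fun y' : Fin n → Y => symbolCount y' = symbolCount y).card : ℝ) *
      permLaw W x y = ∑ z with symbolCount z = symbolCount y, dmcLaw W x z := by
  have h := sum_permLaw_mul W x (fun z => if symbolCount z = symbolCount y then 1 else 0)
    (fun z σ => by rw [symbolCount_comp_perm])
  simp only [mul_ite, mul_one, mul_zero, ← Finset.sum_filter] at h
  rw [← h, Finset.sum_congr rfl (g := fun _ => permLaw W x y)]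
  · simp
  · intro y' hy'
    obtain ⟨σ, rfl⟩ := exists_perm_of_symbolCount_eq (Finset.mem_filter.1 hy').2
    exact (permLaw_comp_perm W x y' σ).symm

end Channel

/-! ### A uniform local bound for the symbol counts -/

section LocalBound

open Real

/-- Orthogonality of characters on the circle; it turns the event that a count has a prescribed
value into an integral over phases. -/
lemma integral_Ioc_exp_int_mul (m : ℤ) :
    ∫ θ in Set.Ioc (-π) π, Complex.exp (m * θ * Complex.I) =
      if m = 0 then ((2 * π : ℝ) : ℂ) else 0 := by
  rw [← intervalIntegral.integral_of_le (by linarith [pi_pos])]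
  split_ifs with hm
  · simp [hm, two_mul]
  · have hc : (m : ℂ) * Complex.I ≠ 0 := by simp [hm]
    have h := integral_exp_mul_complex (a := -π) (b := π) hc
    have h2 : Complex.exp (m * Complex.I * (π : ℝ)) =
        Complex.exp (m * Complex.I * ((-π : ℝ) : ℂ)) := by
      rw [Complex.exp_eq_exp_iff_exists_int]
      refine ⟨m, ?_⟩
      push_cast
      ring
    rw [h2, sub_self, zero_div] at h
    rw [← h]
    congr 1
    funext θ
    congr 1
    ring

variable {X Y : Type*}

/-- Extension by zero of a family of phases indexed by the symbols other than `y₀`. -/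
def extendPhase [DecidableEq Y] (y₀ : Y) (θ : {y // y ≠ y₀} → ℝ) (y : Y) : ℝ :=
  if h : y ≠ y₀ then θ ⟨y, h⟩ else 0

lemma extendPhase_self [DecidableEq Y] (y₀ : Y) (θ : {y // y ≠ y₀} → ℝ) :
    extendPhase y₀ θ y₀ = 0 := by simp [extendPhase]

lemma extendPhase_coe [DecidableEq Y] (y₀ : Y) (θ : {y // y ≠ y₀} → ℝ) (a : {y // y ≠ y₀}) :
    extendPhase y₀ θ a = θ a := by simp [extendPhase, a.2]

variable [Fintype Y]

/-- A probability vector whose entries are at least `w` has a characteristic function that is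
bounded by a Gaussian on the fundamental domain. -/
lemma norm_sum_mul_exp_le {p : Y → ℝ} {w : ℝ} (hw : 0 < w) (hp : ∀ y, w ≤ p y)
    (hsum : ∑ y, p y = 1) {θ : Y → ℝ} {y₀ : Y} (h₀ : θ y₀ = 0) (hθ : ∀ y, |θ y| ≤ π) :
    ‖∑ y, (p y : ℂ) * Complex.exp (θ y * Complex.I)‖ ≤ exp (-(w ^ 2 / π ^ 2) * ∑ y, θ y ^ 2) := by
  set s : ℝ := (w ^ 2 / π ^ 2) * ∑ y, θ y ^ 2 with hs
  have hp0 : ∀ y, 0 ≤ p y := fun y => hw.le.trans (hp y)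
  have hexp : ∑ y, (p y : ℂ) * Complex.exp (θ y * Complex.I) =
      ((∑ y, p y * cos (θ y) : ℝ) : ℂ) + ((∑ y, p y * sin (θ y) : ℝ) : ℂ) * Complex.I := by
    push_cast
    rw [Finset.sum_mul, ← Finset.sum_add_distrib]
    refine Finset.sum_congr rfl fun y _ => ?_
    rw [Complex.exp_mul_I]
    ring
  -- The squared modulus is the characteristic function of the difference of two independent copies.
  have hsq : ‖∑ y, (p y : ℂ) * Complex.exp (θ y * Complex.I)‖ ^ 2 =
      ∑ y, ∑ y', p y * p y' * cos (θ y - θ y') := by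
    rw [hexp, ← Complex.normSq_eq_norm_sq, Complex.normSq_add_mul_I, pow_two, pow_two,
      Finset.sum_mul_sum, Finset.sum_mul_sum, ← Finset.sum_add_distrib]
    refine Finset.sum_congr rfl fun y _ => ?_
    rw [← Finset.sum_add_distrib]
    refine Finset.sum_congr rfl fun y' _ => ?_
    rw [cos_sub]
    ring
  have hone : ∑ y, ∑ y', p y * p y' = 1 := by
    rw [← Finset.sum_mul_sum, hsum, one_mul]
  -- Only the terms with `y' = y₀`, where the phase vanishes, are kept; there `1 - cos θ ≥ 2 θ² /
  -- π²` on `[-π, π]` gives the quadratic gap.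
  have hgap : 2 * s ≤ ∑ y, ∑ y', p y * p y' * (1 - cos (θ y - θ y')) := by
    rw [hs, ← mul_assoc, Finset.mul_sum]
    refine Finset.sum_le_sum fun y _ => ?_
    have hnn : ∀ y' ∈ Finset.univ, 0 ≤ p y * p y' * (1 - cos (θ y - θ y')) := fun y' _ =>
      mul_nonneg (mul_nonneg (hp0 _) (hp0 _)) (sub_nonneg.2 (cos_le_one _))
    refine le_trans ?_ (Finset.single_le_sum hnn (Finset.mem_univ y₀))
    rw [h₀, sub_zero]
    have h1 := cos_le_one_sub_mul_cos_sq (hθ y)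
    have h2 : w * w ≤ p y * p y₀ := mul_le_mul (hp _) (hp _) hw.le (hp0 _)
    calc 2 * (w ^ 2 / π ^ 2) * θ y ^ 2 = w * w * (2 / π ^ 2 * θ y ^ 2) := by ring
      _ ≤ p y * p y₀ * (1 - cos (θ y)) :=
        mul_le_mul h2 (by linarith) (by positivity) (mul_nonneg (hp0 _) (hp0 _))
  have hle : ‖∑ y, (p y : ℂ) * Complex.exp (θ y * Complex.I)‖ ^ 2 ≤ exp (-s) ^ 2 := by
    rw [hsq, ← exp_nat_mul]
    have h3 : ∑ y, ∑ y', p y * p y' * cos (θ y - θ y') =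
        1 - ∑ y, ∑ y', p y * p y' * (1 - cos (θ y - θ y')) := by
      simp only [mul_sub, mul_one, Finset.sum_sub_distrib, hone]
      ring
    have h4 := add_one_le_exp (-(2 * s))
    rw [h3, show ((2 : ℕ) : ℝ) * -s = -(2 * s) by push_cast; ring]
    linarith
  rw [neg_mul, ← hs]
  exact (pow_le_pow_iff_left₀ (norm_nonneg _) (exp_nonneg _) two_ne_zero).1 hle

lemma sum_dmcLaw_mul_prod_complex (W : Matrix X Y ℝ) {n : ℕ} (x : Fin n → X)
    (f : Fin n → Y → ℂ) :
    ∑ z, (dmcLaw W x z : ℂ) * ∏ t, f t (z t) = ∏ t, ∑ y, (W (x t) y : ℂ) * f t y := by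
  classical
  rw [Finset.prod_univ_sum, Fintype.piFinset_univ]
  simp only [dmcLaw, Finset.prod_mul_distrib, Complex.ofReal_prod]

/-- The Fourier integrand factorises over positions into characteristic functions of rows of `W`,
times a unimodular factor carrying `τ`. -/
lemma sum_dmcLaw_mul_prod_exp [DecidableEq Y] (W : Matrix X Y ℝ) {n : ℕ} (x : Fin n → X)
    (τ : Y → ℕ) (y₀ : Y) (θ : {y // y ≠ y₀} → ℝ) :
    ∑ z, (dmcLaw W x z : ℂ) * ∏ a : {y // y ≠ y₀},
        Complex.exp (((symbolCount z a : ℤ) - (τ a : ℤ) : ℤ) * θ a * Complex.I) =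
      (∏ t, ∑ y, (W (x t) y : ℂ) * Complex.exp (extendPhase y₀ θ y * Complex.I)) *
        Complex.exp ((-∑ a : {y // y ≠ y₀}, (τ a : ℝ) * θ a : ℝ) * Complex.I) := by
  rw [← sum_dmcLaw_mul_prod_complex W x
    (fun _ y => Complex.exp (extendPhase y₀ θ y * Complex.I)), Finset.sum_mul]
  refine Finset.sum_congr rfl fun z _ => ?_
  rw [mul_assoc]
  congr 1
  have h : ∑ t, extendPhase y₀ θ (z t) = ∑ a : {y // y ≠ y₀}, (symbolCount z a : ℝ) * θ a := by
    rw [sum_comp_eq_sum_symbolCount, Fintype.sum_eq_add_sum_subtype_ne _ y₀, extendPhase_self,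
      mul_zero, zero_add]
    simp only [extendPhase_coe]
  rw [← Complex.exp_sum, ← Complex.exp_sum, ← Complex.exp_add]
  congr 1
  rw [← Finset.sum_mul, ← Finset.sum_mul, ← add_mul, ← Complex.ofReal_sum, h]
  push_cast
  rw [← sub_eq_add_neg, ← Finset.sum_sub_distrib]
  congr 1
  exact Finset.sum_congr rfl fun a _ => by ring

/-- Any prescribed symbol counts have probability `O(n ^ (-(|Y| - 1) / 2))`, uniformly in the
input word. -/
lemma sum_dmcLaw_symbolCount_le [DecidableEq Y] (W : Matrix X Y ℝ) {w : ℝ} (hw : 0 < w)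
    (hW : ∀ x y, w ≤ W x y) (hsum : ∀ x, ∑ y, W x y = 1) {n : ℕ} (hn : 0 < n)
    (x : Fin n → X) (τ : Y → ℕ) :
    ∑ z with symbolCount z = τ, dmcLaw W x z ≤
      ((2 * π)⁻¹ * √(π / (w ^ 2 / π ^ 2 * n))) ^ (Fintype.card Y - 1) := by
  have hW0 : ∀ x y, 0 ≤ W x y := fun x y => hw.le.trans (hW x y)
  have hYne : Nonempty Y := by
    by_contra hY
    rw [not_nonempty_iff] at hY
    simpa using hsum (x ⟨0, hn⟩)
  obtain ⟨y₀⟩ := hYne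
  set b : ℝ := w ^ 2 / π ^ 2 * n with hb
  have hbpos : 0 < b := by
    have : (0 : ℝ) < n := Nat.cast_pos.2 hn
    have := pi_pos
    positivity
  set μ : Measure ({y // y ≠ y₀} → ℝ) :=
    Measure.pi fun _ => volume.restrict (Set.Ioc (-π) π) with hμ
  set F : ({y // y ≠ y₀} → ℝ) → ℂ := fun θ => ∑ z, (dmcLaw W x z : ℂ) * ∏ a : {y // y ≠ y₀},
    Complex.exp (((symbolCount z a : ℤ) - (τ a : ℤ) : ℤ) * θ a * Complex.I) with hF
  have hcard : Fintype.card {y // y ≠ y₀} = Fintype.card Y - 1 := by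
    simp [Fintype.card_subtype_compl]
  have hint : ∫ θ, F θ ∂μ = ((∑ z, dmcLaw W x z * ∏ a : {y // y ≠ y₀},
      (if symbolCount z a = τ a then 2 * π else 0) : ℝ) : ℂ) := by
    rw [hF, integral_finsetSum, Complex.ofReal_sum]
    · refine Finset.sum_congr rfl fun z _ => ?_
      rw [Complex.ofReal_mul, Complex.ofReal_prod, integral_const_mul, hμ, integral_fintype_prod_eq_prod (𝕜 := ℂ)
        (fun (a : {y // y ≠ y₀}) (s : ℝ) =>
          Complex.exp (((symbolCount z a : ℤ) - (τ a : ℤ) : ℤ) * s * Complex.I))]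
      congr 1
      refine Finset.prod_congr rfl fun a _ => ?_
      rw [integral_Ioc_exp_int_mul]
      by_cases h : symbolCount z a = τ a <;> simp [sub_eq_zero, h]
    · intro z _
      refine Integrable.const_mul (Integrable.fintype_prod
        (f := fun (a : {y // y ≠ y₀}) (s : ℝ) =>
          Complex.exp (((symbolCount z a : ℤ) - (τ a : ℤ) : ℤ) * s * Complex.I)) ?_) _
      intro a
      exact (Continuous.integrableOn_Ioc (by fun_prop))
  have hbound : ∀ᵐ θ ∂μ, ‖F θ‖ ≤ ∏ a : {y // y ≠ y₀}, exp (-b * θ a ^ 2) := by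
    have hmem : ∀ᵐ θ ∂μ, θ ∈ Set.univ.pi fun _ : {y // y ≠ y₀} => Set.Ioc (-π) π := by
      rw [hμ, ← Measure.restrict_pi_pi]
      exact ae_restrict_mem (MeasurableSet.univ_pi fun _ => measurableSet_Ioc)
    filter_upwards [hmem] with θ hθ
    have habs : ∀ y, |extendPhase y₀ θ y| ≤ π := by
      intro y
      unfold extendPhase
      split_ifs with h
      · have := hθ ⟨y, h⟩ (Set.mem_univ _)
        exact abs_le.2 ⟨this.1.le, this.2⟩
      · simpa using pi_pos.le
    rw [hF]
    simp only
    rw [sum_dmcLaw_mul_prod_exp, norm_mul, Complex.norm_exp_ofReal_mul_I, mul_one, norm_prod]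
    calc _ ≤ ∏ _t : Fin n, exp (-(w ^ 2 / π ^ 2) * ∑ y, extendPhase y₀ θ y ^ 2) :=
          Finset.prod_le_prod (fun _ _ => norm_nonneg _) fun t _ =>
            norm_sum_mul_exp_le hw (hW _) (hsum _) (extendPhase_self y₀ θ) habs
      _ = _ := by
        rw [Finset.prod_const, Finset.card_univ, Fintype.card_fin, ← exp_nat_mul, ← exp_sum,
          Fintype.sum_eq_add_sum_subtype_ne _ y₀, extendPhase_self]
        simp only [extendPhase_coe, ← Finset.mul_sum, hb]
        congr 1
        ring
  have hgi : Integrable (fun θ : {y // y ≠ y₀} → ℝ => ∏ a, exp (-b * θ a ^ 2)) μ :=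
    Integrable.fintype_prod (f := fun _ s => exp (-b * s ^ 2)) fun _ =>
      (integrable_exp_neg_mul_sq hbpos).restrict
  have hmain := norm_integral_le_of_norm_le hgi hbound
  rw [hint, hμ, integral_fintype_prod_eq_prod (fun _ s => exp (-b * s ^ 2)), Finset.prod_const,
    Finset.card_univ, hcard, Complex.norm_real] at hmain
  have hgauss : ∫ s in Set.Ioc (-π) π, exp (-b * s ^ 2) ≤ √(π / b) := by
    rw [← integral_gaussian]
    exact setIntegral_le_integral (integrable_exp_neg_mul_sq hbpos)
      (Filter.Eventually.of_forall fun s => (exp_pos _).le)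
  -- Words with counts `τ` are among those that agree with `τ` away from `y₀`, and each of them
  -- contributes a full `(2π) ^ (|Y| - 1)`.
  have hlow : (∑ z with symbolCount z = τ, dmcLaw W x z) * (2 * π) ^ (Fintype.card Y - 1) ≤
      ∑ z, dmcLaw W x z * ∏ a : {y // y ≠ y₀}, (if symbolCount z a = τ a then 2 * π else 0) := by
    have hterm : ∀ z, 0 ≤ dmcLaw W x z *
        ∏ a : {y // y ≠ y₀}, (if symbolCount z a = τ a then 2 * π else 0) := fun z =>
      mul_nonneg (dmcLaw_nonneg W hW0 _ _) (Finset.prod_nonneg fun a _ => by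
        split_ifs
        · exact (mul_pos two_pos pi_pos).le
        · exact le_rfl)
    rw [Finset.sum_mul]
    refine le_trans (Finset.sum_le_sum fun z hz => ?_)
      (Finset.sum_le_sum_of_subset_of_nonneg (Finset.filter_subset (symbolCount · = τ) _)
        fun z _ _ => hterm z)
    have hz := (Finset.mem_filter.1 hz).2
    simp [hz, hcard]
  have hpow : (∫ s in Set.Ioc (-π) π, exp (-b * s ^ 2)) ^ (Fintype.card Y - 1) ≤
      √(π / b) ^ (Fintype.card Y - 1) :=
    pow_le_pow_left₀ (integral_nonneg fun s => (exp_pos _).le) hgauss _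
  have hfin := (hlow.trans (le_abs_self _)).trans (hmain.trans hpow)
  rw [mul_pow, inv_pow, inv_mul_eq_div, le_div_iff₀ (pow_pos (mul_pos two_pos pi_pos) _)]
  exact hfin

end LocalBound

/-! ### Linear algebra of the channel matrix -/

section LinearAlgebra

variable {X Y : Type*} [Fintype X]

lemma span_polytope (W : Matrix X Y ℝ) :
    Submodule.span ℝ (polytope W) =
      (Submodule.span ℝ (Set.range W.row)).map
        (WithLp.linearEquiv 2 ℝ (Y → ℝ)).symm.toLinearMap := by
  classical
  refine le_antisymm (Submodule.span_le.2 ?_) ?_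
  · rintro _ ⟨p, -, rfl⟩
    refine ⟨Matrix.vecMul p W, ?_, rfl⟩
    have : Matrix.vecMul p W = ∑ x, p x • W.row x := by
      funext y
      simp [Matrix.vecMul, dotProduct, Matrix.row]
    rw [this]
    exact Submodule.sum_mem _ fun x _ =>
      Submodule.smul_mem _ _ (Submodule.subset_span (Set.mem_range_self x))
  · rw [Submodule.map_span, Submodule.span_le]
    rintro _ ⟨_, ⟨x, rfl⟩, rfl⟩
    refine Submodule.subset_span ⟨Pi.single x 1, single_mem_stdSimplex ℝ x, ?_⟩
    rw [Matrix.single_one_vecMul]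
    rfl

variable [Fintype Y]

/-- If a functional is identically `1` on `s`, then the linear span of `s` has one dimension more
than the affine span. -/
lemma finrank_span_eq_finrank_vectorSpan_add_one {V : Type*} [AddCommGroup V] [Module ℝ V]
    [FiniteDimensional ℝ V] {s : Set V} (hs : s.Nonempty) (f : V →ₗ[ℝ] ℝ)
    (hf : ∀ v ∈ s, f v = 1) :
    Module.finrank ℝ (Submodule.span ℝ s) = Module.finrank ℝ (vectorSpan ℝ s) + 1 := by
  obtain ⟨p, hp⟩ := hs
  have hp0 : p ≠ 0 := by
    rintro rfl
    simpa using hf 0 hp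
  have hker : vectorSpan ℝ s ≤ LinearMap.ker f := by
    rw [vectorSpan_def, Submodule.span_le]
    rintro _ ⟨a, ha, b, hb, rfl⟩
    simp [hf a ha, hf b hb]
  have hsup : Submodule.span ℝ s = vectorSpan ℝ s ⊔ Submodule.span ℝ {p} := by
    refine le_antisymm (Submodule.span_le.2 fun v hv => ?_) (sup_le ?_ ?_)
    · have h1 : v - p ∈ vectorSpan ℝ s := vsub_mem_vectorSpan ℝ hv hp
      have h2 := Submodule.add_mem_sup h1 (Submodule.mem_span_singleton_self (R := ℝ) p)
      simpa using h2
    · rw [vectorSpan_def, Submodule.span_le]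
      rintro _ ⟨a, ha, b, hb, rfl⟩
      exact Submodule.sub_mem _ (Submodule.subset_span ha) (Submodule.subset_span hb)
    · exact Submodule.span_mono (Set.singleton_subset_iff.2 hp)
  have hinf : vectorSpan ℝ s ⊓ Submodule.span ℝ {p} = ⊥ := by
    rw [eq_bot_iff]
    rintro v ⟨hv, hvp⟩
    obtain ⟨c, rfl⟩ := Submodule.mem_span_singleton.1 hvp
    have : f (c • p) = 0 := hker hv
    rw [map_smul, hf p hp, smul_eq_mul, mul_one] at this
    simp [this]
  have h := Submodule.finrank_sup_add_finrank_inf_eq (vectorSpan ℝ s) (Submodule.span ℝ {p})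
  rw [hinf, finrank_bot, add_zero, finrank_span_singleton hp0, ← hsup] at h
  exact h

/-- The coordinate sum is `1` on the polytope, so its linear span, which is the row space, exceeds
its affine dimension by one. -/
lemma rank_eq_affDim_add_one [Nonempty X] (W : Matrix X Y ℝ) (hsum : ∀ x, ∑ y, W x y = 1) :
    W.rank = affDim W + 1 := by
  have h := finrank_span_eq_finrank_vectorSpan_add_one (s := polytope W)
    (Set.nonempty_coe_sort.1 inferInstance)
    ((∑ y, LinearMap.proj y : (Y → ℝ) →ₗ[ℝ] ℝ) ∘ₗ
      (WithLp.linearEquiv 2 ℝ (Y → ℝ)).toLinearMap) (by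
      rintro _ ⟨p, hp, rfl⟩
      simp only [LinearMap.comp_apply, LinearMap.sum_apply, LinearMap.proj_apply]
      change ∑ y, ∑ x, p x * W x y = 1
      rw [Finset.sum_comm]
      simp only [← Finset.mul_sum, hsum, mul_one, hp.2])
  rw [span_polytope, LinearEquiv.finrank_map_eq, ← Matrix.rank_eq_finrank_span_row] at h
  rw [h, affDim, hull, direction_affineSpan]

/-- The columns of a stochastic matrix are affine functions of `affDim W` of them. -/
lemma exists_affine_column_basis [Nonempty X] [DecidableEq Y] (W : Matrix X Y ℝ)
    (hsum : ∀ x, ∑ y, W x y = 1) :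
    ∃ (I : Finset Y) (a : Y → ℝ) (L : Y → Y → ℝ), I.card = affDim W ∧ (∃ y₀, y₀ ∉ I) ∧
      ∀ x j, W x j = a j + ∑ i ∈ I, L j i * W x i := by
  classical
  -- The constant vector `1`, indexed by `none`, joins the columns. It is their sum, so extending it
  -- to a basis of the column space uses exactly `d` columns.
  set v : Option Y → (X → ℝ) := fun o => o.elim 1 W.col with hv
  have h1 : LinearIndepOn ℝ v {none} := by
    rw [linearIndepOn_singleton_iff]
    exact one_ne_zero
  obtain ⟨b, -, hnb, hspan, hli⟩ := exists_linearIndepOn_extension h1 (Set.subset_univ _)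
  have hspan' : Submodule.span ℝ (v '' b) = Submodule.span ℝ (Set.range W.col) := by
    refine le_antisymm (Submodule.span_le.2 ?_) (Submodule.span_le.2 ?_)
    · rintro _ ⟨o, -, rfl⟩
      cases o with
      | none =>
        have : v none = ∑ y, W.col y := by
          funext x
          rw [Finset.sum_apply]
          exact (hsum x).symm
        rw [this]
        exact Submodule.sum_mem _ fun y _ => Submodule.subset_span (Set.mem_range_self y)
      | some y => exact Submodule.subset_span (Set.mem_range_self y)
    · rintro _ ⟨y, rfl⟩
      exact hspan ⟨some y, Set.mem_univ _, rfl⟩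
  have hcard : b.toFinset.card = affDim W + 1 := by
    rw [← rank_eq_affDim_add_one W hsum, Matrix.rank_eq_finrank_span_cols, ← hspan',
      Set.toFinset_card, Set.image_eq_range]
    exact (finrank_span_eq_card (R := ℝ) hli.linearIndependent).symm
  set I : Finset Y := Finset.univ.filter fun y => some y ∈ b with hI
  have hb : b.toFinset = Finset.insertNone I := by
    ext o
    cases o with
    | none => simpa using hnb (Set.mem_singleton _)
    | some y => simp [hI]
  have hIcard : I.card = affDim W := by
    rw [hb, Finset.card_insertNone] at hcard
    omega
  have hcomb : ∀ j, ∃ c : Option Y → ℝ, ∑ o ∈ b.toFinset, c o • v o = W.col j := by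
    intro j
    have : W.col j ∈ Submodule.span ℝ (v '' (b.toFinset : Set (Option Y))) := by
      rw [Set.coe_toFinset, hspan']
      exact Submodule.subset_span (Set.mem_range_self j)
    obtain ⟨c, hc⟩ := (Submodule.mem_span_image_finset_iff_exists_fun ℝ).1 this
    refine ⟨fun o => if h : o ∈ b.toFinset then c ⟨o, h⟩ else 0, ?_⟩
    rw [← hc, ← Finset.sum_coe_sort]
    exact Finset.sum_congr rfl fun o _ => congrArg (· • v o) (dif_pos o.2)
  choose c hc using hcomb
  refine ⟨I, fun j => c j none, fun j i => c j (some i), hIcard, ?_, ?_⟩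
  · by_contra! hall
    have hIu : I = Finset.univ := Finset.eq_univ_iff_forall.2 hall
    have h2 := W.rank_le_card_width
    rw [rank_eq_affDim_add_one W hsum, ← hIcard, hIu, Finset.card_univ] at h2
    omega
  · intro x j
    have := congrFun (hc j) x
    rw [hb, Finset.sum_insertNone] at this
    rw [Pi.add_apply, Finset.sum_apply] at this
    have hnone : (c j none • v none) x = c j none := mul_one _
    rw [hnone] at this
    exact this.symm

/-- There are `rank W` rows of `W` with a dual family of functions on the output alphabet. -/
lemma exists_row_basis_dual [DecidableEq X] (W : Matrix X Y ℝ) :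
    ∃ (B : Finset X) (g : X → Y → ℝ), B.card = W.rank ∧
      ∀ x ∈ B, ∀ x' ∈ B, ∑ y, W x y * g x' y = if x = x' then 1 else 0 := by
  classical
  obtain ⟨b, -, -, hspan, hli⟩ := exists_linearIndepOn_extension
    (linearIndepOn_empty ℝ W.row) (Set.subset_univ _)
  have hspan' : Submodule.span ℝ (W.row '' b) = Submodule.span ℝ (Set.range W.row) := by
    refine le_antisymm (Submodule.span_mono (Set.image_subset_range _ _)) (Submodule.span_le.2 ?_)
    rwa [Set.image_univ] at hspan
  have hcard : b.toFinset.card = W.rank := by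
    rw [Matrix.rank_eq_finrank_span_row, ← hspan', Set.toFinset_card, Set.image_eq_range]
    exact (finrank_span_eq_card (R := ℝ) hli.linearIndependent).symm
  set A : Matrix b Y ℝ := Matrix.of fun x y => W x y with hA
  have hArank : A.rank = Fintype.card b := LinearIndependent.rank_matrix (M := A) hli.linearIndependent
  have hsurj : Function.Surjective A.mulVec := by
    have : LinearMap.range A.mulVecLin = ⊤ := by
      apply Submodule.eq_top_of_finrank_eq
      rw [Module.finrank_fintype_fun_eq_card, ← hArank]
      rfl
    exact LinearMap.range_eq_top.1 this
  -- The chosen rows are independent, so `A` has full row rank; the columns of a right inverse are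
  -- the dual functions.
  obtain ⟨G, hG⟩ := Matrix.mulVec_surjective_iff_exists_right_inverse.1 hsurj
  refine ⟨b.toFinset, fun x y => if h : x ∈ b then G y ⟨x, h⟩ else 0, hcard, ?_⟩
  intro x hx x' hx'
  rw [Set.mem_toFinset] at hx hx'
  have := congrFun (congrFun hG ⟨x, hx⟩) ⟨x', hx'⟩
  simpa [Matrix.mul_apply, hA, hx', Matrix.one_apply] using this

end LinearAlgebra

/-! ### The converse bound -/

section Converse

variable {X Y : Type*} [Fintype Y] [DecidableEq Y]

open scoped Classical in
/-- The symbol counts of words of length `n` that are within `R` of the mean counts of some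
input word. -/
def nearCounts (W : Matrix X Y ℝ) (n : ℕ) (R : ℝ) : Finset (Y → ℕ) :=
  (Fintype.piFinset fun _ => Finset.range (n + 1)).filter fun τ =>
    ∑ y, τ y = n ∧ ∃ x : Fin n → X, ∀ y, |(τ y : ℝ) - ∑ t, W (x t) y| < R

lemma mem_nearCounts {W : Matrix X Y ℝ} {n : ℕ} {R : ℝ} {τ : Y → ℕ} :
    τ ∈ nearCounts W n R ↔ (∀ y, τ y ≤ n) ∧ ∑ y, τ y = n ∧
      ∃ x : Fin n → X, ∀ y, |(τ y : ℝ) - ∑ t, W (x t) y| < R := by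
  simp [nearCounts]

lemma symbolCount_mem_nearCounts (W : Matrix X Y ℝ) {n : ℕ} {R : ℝ} (x : Fin n → X)
    (z : Fin n → Y) (h : ∀ y, |(symbolCount z y : ℝ) - ∑ t, W (x t) y| < R) :
    symbolCount z ∈ nearCounts W n R := by
  refine mem_nearCounts.2 ⟨fun y => ?_, sum_symbolCount z, x, h⟩
  conv_rhs => rw [← sum_symbolCount z]
  exact Finset.single_le_sum (fun _ _ => Nat.zero_le _) (Finset.mem_univ y)

/-- Mean counts satisfy the column relations `hL` exactly, so the counts on `I` determine every
other count up to `(1 + Λ) * R`, and the total `n` recovers the count of `y₀`. -/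
lemma card_nearCounts_le (W : Matrix X Y ℝ) {n : ℕ} {R Λ : ℝ} (hR : 0 < R) {I : Finset Y}
    {a : Y → ℝ} {L : Y → Y → ℝ} {y₀ : Y} (hy₀ : y₀ ∉ I)
    (hL : ∀ x j, W x j = a j + ∑ i ∈ I, L j i * W x i) (hΛ : ∀ j, ∑ i ∈ I, |L j i| ≤ Λ) :
    ((nearCounts W n R).card : ℝ) ≤
      (n + 1) ^ I.card * (2 * ((1 + Λ) * R) + 1) ^ (Fintype.card Y - 1 - I.card) := by
  set ρ := (1 + Λ) * R with hρ
  have hΛ0 : 0 ≤ Λ := (Finset.sum_nonneg fun _ _ => abs_nonneg _).trans (hΛ y₀)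
  have hρ0 : 0 ≤ ρ := by positivity
  have hnear : ∀ τ ∈ nearCounts W n R, ∀ j,
      |(τ j : ℝ) - (n * a j + ∑ i ∈ I, L j i * τ i)| ≤ ρ := by
    intro τ hτ j
    obtain ⟨-, -, x, hx⟩ := mem_nearCounts.1 hτ
    have hm : ∑ t, W (x t) j = n * a j + ∑ i ∈ I, L j i * ∑ t, W (x t) i := by
      rw [Finset.sum_congr rfl fun t _ => hL (x t) j, Finset.sum_add_distrib, Finset.sum_comm]
      simp [Finset.mul_sum]
    have hsplit : (τ j : ℝ) - (n * a j + ∑ i ∈ I, L j i * τ i) =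
        (τ j - ∑ t, W (x t) j) - ∑ i ∈ I, L j i * (τ i - ∑ t, W (x t) i) := by
      rw [hm]
      simp only [mul_sub, Finset.sum_sub_distrib]
      ring
    rw [hsplit]
    calc _ ≤ |(τ j : ℝ) - ∑ t, W (x t) j| + |∑ i ∈ I, L j i * (τ i - ∑ t, W (x t) i)| :=
          abs_sub _ _
      _ ≤ R + ∑ i ∈ I, |L j i| * R := by
          refine add_le_add (hx j).le ((Finset.abs_sum_le_sum_abs _ _).trans
            (Finset.sum_le_sum fun i _ => ?_))
          rw [abs_mul]
          exact mul_le_mul_of_nonneg_left (hx i).le (abs_nonneg _)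
      _ ≤ ρ := by
          rw [← Finset.sum_mul, hρ, add_mul, one_mul]
          gcongr
          exact hΛ j
  -- The least integer in the window allowed for count `j`; it depends on `τ` only through `I`,
  -- which makes `Ψ` below injective.
  set off : (Y → ℕ) → Y → ℤ := fun τ j => ⌈n * a j + ∑ i ∈ I, L j i * τ i - ρ⌉ with hoff
  set Ψ : (Y → ℕ) → Y → ℤ := fun τ j =>
    if j ∈ I then (τ j : ℤ) else if j = y₀ then 0 else τ j - off τ j with hΨ
  set box : Finset (Y → ℤ) := Fintype.piFinset fun j =>
    if j ∈ I then Finset.Icc (0 : ℤ) n else if j = y₀ then {0} else Finset.Icc 0 ⌊2 * ρ⌋ with hbox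
  have hmaps : ∀ τ ∈ nearCounts W n R, Ψ τ ∈ box := by
    intro τ hτ
    refine Fintype.mem_piFinset.2 fun j => ?_
    simp only [hΨ]
    split_ifs with h1 h2
    · have := (mem_nearCounts.1 hτ).1 j
      rw [Finset.mem_Icc]
      omega
    · simp
    · have h := abs_le.1 (hnear τ hτ j)
      rw [Finset.mem_Icc]
      constructor
      · have : off τ j ≤ τ j := Int.ceil_le.2 (by push_cast; linarith [h.1])
        linarith
      · rw [Int.le_floor]
        have := Int.le_ceil (n * a j + ∑ i ∈ I, L j i * τ i - ρ)
        push_cast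
        simp only [hoff]
        linarith [h.2]
  have hinj : Set.InjOn Ψ (nearCounts W n R) := by
    intro τ hτ τ' hτ' h
    have hI : ∀ j ∈ I, τ j = τ' j := by
      intro j hj
      have := congrFun h j
      simp only [hΨ, if_pos hj] at this
      exact_mod_cast this
    have hoffeq : off τ = off τ' := by
      funext j
      simp only [hoff]
      rw [Finset.sum_congr rfl fun i hi => by rw [hI i hi]]
    have hne : ∀ j, j ≠ y₀ → τ j = τ' j := by
      intro j hj
      by_cases hjI : j ∈ I
      · exact hI j hjI
      · have := congrFun h j
        simp only [hΨ, if_neg hjI, if_neg hj, hoffeq] at this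
        omega
    funext j
    by_cases hj : j = y₀
    · subst hj
      have h1 := (mem_nearCounts.1 hτ).2.1
      have h2 := (mem_nearCounts.1 hτ').2.1
      rw [← Finset.add_sum_erase _ _ (Finset.mem_univ j)] at h1 h2
      have h3 : ∑ i ∈ Finset.univ.erase j, τ i = ∑ i ∈ Finset.univ.erase j, τ' i :=
        Finset.sum_congr rfl fun i hi => hne i (Finset.ne_of_mem_erase hi)
      linarith
    · exact hne j hj
  have hcard := Finset.card_le_card_of_injOn Ψ hmaps hinj
  have hboxcard : box.card =
      (n + 1) ^ I.card * (⌊2 * ρ⌋ + 1).toNat ^ (Fintype.card Y - 1 - I.card) := by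
    rw [hbox, Fintype.card_piFinset]
    have : ∀ j, (if j ∈ I then Finset.Icc (0 : ℤ) n
        else if j = y₀ then {0} else Finset.Icc 0 ⌊2 * ρ⌋).card =
        if j ∈ I then n + 1 else if j ∈ (insert y₀ I)ᶜ then (⌊2 * ρ⌋ + 1).toNat else 1 := by
      intro j
      by_cases h1 : j ∈ I
      · simp only [if_pos h1, Int.card_Icc]
        omega
      · by_cases h2 : j = y₀ <;> simp [h1, h2, hy₀]
    rw [Finset.prod_congr rfl fun j _ => this j, Finset.prod_ite]
    congr 1
    · simp
    · rw [Finset.prod_ite, Finset.prod_const_one, mul_one, Finset.prod_const]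
      congr 1
      rw [Nat.sub_sub, Nat.add_comm, ← Finset.card_insert_of_notMem hy₀, ← Finset.card_compl]
      congr 1
      ext j
      simp only [Finset.mem_filter, Finset.mem_univ, true_and, Finset.mem_compl,
        Finset.mem_insert]
      tauto
  have hfl : (((⌊2 * ρ⌋ + 1).toNat : ℕ) : ℝ) ≤ 2 * ρ + 1 := by
    have h0 : 0 ≤ ⌊2 * ρ⌋ := Int.floor_nonneg.2 (by positivity)
    have : (((⌊2 * ρ⌋ + 1).toNat : ℕ) : ℤ) = ⌊2 * ρ⌋ + 1 := Int.toNat_of_nonneg (by omega)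
    have h2 : (((⌊2 * ρ⌋ + 1).toNat : ℕ) : ℝ) = ⌊2 * ρ⌋ + 1 := by exact_mod_cast this
    rw [h2]
    linarith [Int.floor_le (2 * ρ)]
  calc ((nearCounts W n R).card : ℝ) ≤ (box.card : ℝ) := by exact_mod_cast hcard
    _ = (n + 1) ^ I.card *
        (((⌊2 * ρ⌋ + 1).toNat : ℕ) : ℝ) ^ (Fintype.card Y - 1 - I.card) := by
        rw [hboxcard]; push_cast; rfl
    _ ≤ _ := by gcongr

/-- Chebyshev for the indicator of each symbol, with `G = 1`, and a union bound over symbols. -/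
lemma sum_dmcLaw_not_mem_nearCounts_le (W : Matrix X Y ℝ) (hW : ∀ x y, 0 ≤ W x y)
    (hsum : ∀ x, ∑ y, W x y = 1) {n : ℕ} {R : ℝ} (hR : 0 < R) (x : Fin n → X) :
    ∑ z with symbolCount z ∉ nearCounts W n R, dmcLaw W x z ≤
      Fintype.card Y * (n * 4 / R ^ 2) := by
  have hch : ∀ y, ∑ z with R ≤ |(symbolCount z y : ℝ) - ∑ t, W (x t) y|, dmcLaw W x z ≤
      n * 4 / R ^ 2 := by
    intro y
    have h := chebyshev_dmcLaw W hW hsum x (fun y' => if y' = y then 1 else 0) (G := 1)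
      (fun y' => by split_ifs <;> simp) hR
    have h2 : ∀ z : Fin n → Y, ∑ t, (if z t = y then (1 : ℝ) else 0) = symbolCount z y := by
      intro z
      simp [symbolCount]
    simp only [h2, mul_ite, mul_one, mul_zero, Finset.sum_ite_eq', Finset.mem_univ, if_true] at h
    norm_num at h
    exact h
  calc _ ≤ ∑ z with ∃ y, R ≤ |(symbolCount z y : ℝ) - ∑ t, W (x t) y|, dmcLaw W x z := by
        refine Finset.sum_le_sum_of_subset_of_nonneg (fun z hz => ?_)
          fun z _ _ => dmcLaw_nonneg W hW _ _
        rw [Finset.mem_filter] at hz ⊢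
        refine ⟨hz.1, ?_⟩
        by_contra! hcon
        exact hz.2 (symbolCount_mem_nearCounts W x z hcon)
    _ ≤ ∑ y, ∑ z with R ≤ |(symbolCount z y : ℝ) - ∑ t, W (x t) y|, dmcLaw W x z :=
        sum_filter_exists_le _ fun z => dmcLaw_nonneg W hW _ _
    _ ≤ ∑ _y : Y, n * 4 / R ^ 2 := Finset.sum_le_sum fun y _ => hch y
    _ = _ := by simp

/-- The expected number of correct decodings is bounded by the atypical mass plus the number of
reachable symbol counts times the largest point probability. -/
lemma card_mul_one_sub_errProb_le (W : Matrix X Y ℝ) (hW : ∀ x y, 0 ≤ W x y)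
    (hsum : ∀ x, ∑ y, W x y = 1) {n M : ℕ} (hM : 0 < M) (C : Code X Y n M) (G : Finset (Y → ℕ))
    {δ P : ℝ} (hδ : ∀ x : Fin n → X, ∑ z with symbolCount z ∉ G, dmcLaw W x z ≤ δ)
    (hP : ∀ (x : Fin n → X) τ, ∑ z with symbolCount z = τ, dmcLaw W x z ≤ P) :
    (M : ℝ) * (1 - errProb W C) ≤ M * δ + G.card * P := by
  have hM' : (M : ℝ) ≠ 0 := by positivity
  have hP0 : 0 ≤ P := (Finset.sum_nonneg fun _ _ => dmcLaw_nonneg W hW _ _).trans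
    (hP (C.enc ⟨0, hM⟩) 0)
  have hperm0 := fun (x : Fin n → X) y => permLaw_nonneg W hW x y
  have hsucc : (M : ℝ) * (1 - errProb W C) =
      ∑ u, ∑ y, if C.dec y = some u then permLaw W (C.enc u) y else 0 := by
    have h1 : ∀ u, ∑ y, (if C.dec y = some u then permLaw W (C.enc u) y else 0) =
        1 - ∑ y, if C.dec y ≠ some u then permLaw W (C.enc u) y else 0 := by
      intro u
      rw [← sum_permLaw W hsum (C.enc u), ← Finset.sum_sub_distrib]
      refine Finset.sum_congr rfl fun y _ => ?_
      by_cases h : C.dec y = some u <;> simp [h]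
    rw [Finset.sum_congr rfl fun u _ => h1 u, Finset.sum_sub_distrib, errProb, mul_sub,
      mul_div_cancel₀ _ hM']
    simp
  have hsplit : ∀ u, ∑ y, (if C.dec y = some u then permLaw W (C.enc u) y else 0) ≤
      δ + ∑ y with symbolCount y ∈ G, if C.dec y = some u then permLaw W (C.enc u) y else 0 := by
    intro u
    rw [← Finset.sum_filter_add_sum_filter_not Finset.univ (fun y => symbolCount y ∈ G), add_comm]
    gcongr
    refine le_trans ?_ (hδ (C.enc u))
    have h := sum_permLaw_mul W (C.enc u) (fun z => if symbolCount z ∉ G then 1 else 0)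
      (fun z σ => by rw [symbolCount_comp_perm])
    simp only [mul_ite, mul_one, mul_zero, ← Finset.sum_filter] at h
    rw [← h]
    refine Finset.sum_le_sum fun y _ => ?_
    split_ifs
    exacts [le_rfl, hperm0 _ _]
  set cls : (Y → ℕ) → ℝ := fun τ =>
    ((Finset.univ.filter fun y : Fin n → Y => symbolCount y = τ).card : ℝ) with hcls
  -- The decoder names at most one message at `y`, and the output law is uniform on the class of
  -- words with the counts of `y`.
  have hpoint : ∀ y : Fin n → Y,
      ∑ u, (if C.dec y = some u then permLaw W (C.enc u) y else 0) ≤ P / cls (symbolCount y) := by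
    intro y
    have hc : 0 < cls (symbolCount y) := by
      simp only [hcls, Nat.cast_pos, Finset.card_pos]
      exact ⟨y, by simp⟩
    have hle : ∀ x : Fin n → X, permLaw W x y ≤ P / cls (symbolCount y) := by
      intro x
      rw [le_div_iff₀ hc, mul_comm]
      exact (card_mul_permLaw W x y).trans_le (hP x _)
    cases hdec : C.dec y with
    | none => simpa using div_nonneg hP0 hc.le
    | some v => simpa using hle (C.enc v)
  have hgood : ∑ y : Fin n → Y with symbolCount y ∈ G, P / cls (symbolCount y) ≤ G.card * P := by
    rw [← Finset.sum_fiberwise_of_maps_to (s := Finset.univ.filter fun y : Fin n → Y =>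
      symbolCount y ∈ G) (t := G) (g := symbolCount) (fun y hy => (Finset.mem_filter.1 hy).2),
      ← nsmul_eq_mul]
    refine Finset.sum_le_card_nsmul _ _ _ fun τ hτ => ?_
    have hfil : ((Finset.univ.filter fun y : Fin n → Y => symbolCount y ∈ G).filter
        fun y => symbolCount y = τ) = Finset.univ.filter fun y => symbolCount y = τ := by
      ext y
      simp only [Finset.mem_filter, Finset.mem_univ, true_and, and_iff_right_iff_imp]
      rintro rfl
      exact hτ
    rw [hfil, Finset.sum_congr rfl (g := fun _ => P / cls τ)
      (fun y hy => by rw [(Finset.mem_filter.1 hy).2]), Finset.sum_const, nsmul_eq_mul]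
    -- For an empty class the quotient is zero by convention.
    by_cases h0 : cls τ = 0
    · simpa [h0] using hP0
    · exact (mul_div_cancel₀ _ h0).le
  rw [hsucc]
  calc _ ≤ ∑ u, (δ + ∑ y with symbolCount y ∈ G,
        if C.dec y = some u then permLaw W (C.enc u) y else 0) :=
        Finset.sum_le_sum fun u _ => hsplit u
    _ = M * δ + ∑ y with symbolCount y ∈ G,
        ∑ u, if C.dec y = some u then permLaw W (C.enc u) y else 0 := by
        rw [Finset.sum_add_distrib, Finset.sum_comm]
        simp
    _ ≤ _ := by
        gcongr
        exact (Finset.sum_le_sum fun y _ => hpoint y).trans hgood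

/-- Strong converse with the exact power of the blocklength. -/
lemma exists_forall_code_le [Fintype X] [Nonempty X] (W : Matrix X Y ℝ) (hpos : ∀ x y, 0 < W x y)
    (hsum : ∀ x, ∑ y, W x y = 1) {ε : ℝ} (hε : ε < 1) :
    ∃ K : ℝ, 0 < K ∧ ∀ n : ℕ, 0 < n → ∀ M : ℕ, 0 < M → ∀ C : Code X Y n M, errProb W C ≤ ε →
      (M : ℝ) ≤ K * √n ^ affDim W := by
  have hW : ∀ x y, 0 ≤ W x y := fun x y => (hpos x y).le
  have hYne : Nonempty Y := by
    by_contra hY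
    rw [not_nonempty_iff] at hY
    simpa using hsum (Classical.arbitrary X)
  obtain ⟨I, a, L, hIcard, ⟨y₀, hy₀⟩, hL⟩ := exists_affine_column_basis W hsum
  obtain ⟨w, hw, hwW⟩ : ∃ w, 0 < w ∧ ∀ x y, w ≤ W x y := by
    obtain ⟨q, -, hq⟩ := Finset.exists_min_image Finset.univ (fun q : X × Y => W q.1 q.2)
      Finset.univ_nonempty
    exact ⟨W q.1 q.2, hpos _ _, fun x y => hq (x, y) (Finset.mem_univ _)⟩
  set k := Fintype.card Y with hk
  have hk0 : 0 < k := Fintype.card_pos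
  set d := affDim W with hd
  have hdk : d ≤ k - 1 := by
    have : (insert y₀ I).card ≤ k := Finset.card_le_univ _
    rw [Finset.card_insert_of_notMem hy₀, hIcard] at this
    omega
  set Λ := ∑ j, ∑ i ∈ I, |L j i| with hΛdef
  have hΛ : ∀ j, ∑ i ∈ I, |L j i| ≤ Λ := fun j =>
    Finset.single_le_sum (f := fun j => ∑ i ∈ I, |L j i|)
      (fun _ _ => Finset.sum_nonneg fun _ _ => abs_nonneg _) (Finset.mem_univ j)
  have hΛ0 : 0 ≤ Λ := (Finset.sum_nonneg fun _ _ => abs_nonneg _).trans (hΛ y₀)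
  -- Makes the Chebyshev bound `k * 4 / B ^ 2` equal to `(1 - ε) / 2`, so atypical outputs cost half
  -- of the success probability.
  set B := √(8 * k / (1 - ε)) with hB
  have h1ε : 0 < 1 - ε := by linarith
  have hk0' : (0 : ℝ) < k := Nat.cast_pos.2 hk0
  have hB0 : 0 < B := Real.sqrt_pos.2 (by positivity)
  have hB2 : B ^ 2 = 8 * k / (1 - ε) := Real.sq_sqrt (by positivity)
  set c₁ := 2 * ((1 + Λ) * B) + 1 with hc₁
  have hc₁0 : 0 < c₁ := by positivity
  set c₂ := (2 * Real.pi)⁻¹ * √(Real.pi / (w ^ 2 / Real.pi ^ 2)) with hc₂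
  have hc₂0 : 0 < c₂ := by
    have := Real.pi_pos
    exact mul_pos (by positivity) (Real.sqrt_pos.2 (by positivity))
  refine ⟨2 / (1 - ε) * (2 ^ d * c₁ ^ (k - 1 - d) * c₂ ^ (k - 1)), by positivity, ?_⟩
  intro n hn M hM C hC
  have hn1 : (1 : ℝ) ≤ n := Nat.one_le_cast.2 hn
  set s := √(n : ℝ) with hs
  have hs1 : 1 ≤ s := Real.one_le_sqrt.2 hn1
  have hs0 : 0 < s := by linarith
  have hs2 : s ^ 2 = n := Real.sq_sqrt (by positivity)
  set G := nearCounts W n (B * s) with hG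
  have hδ : ∀ x : Fin n → X, ∑ z with symbolCount z ∉ G, dmcLaw W x z ≤ (1 - ε) / 2 := by
    intro x
    refine (sum_dmcLaw_not_mem_nearCounts_le W hW hsum (by positivity) x).trans_eq ?_
    rw [mul_pow, hB2, hs2, ← hk]
    field_simp
    norm_num
  have hP : ∀ (x : Fin n → X) τ, ∑ z with symbolCount z = τ, dmcLaw W x z ≤
      (c₂ / s) ^ (k - 1) := by
    intro x τ
    refine (sum_dmcLaw_symbolCount_le W hw hwW hsum hn x τ).trans_eq ?_
    rw [← div_div, Real.sqrt_div' _ (by positivity), ← mul_div_assoc]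
  have hGcard : (G.card : ℝ) ≤ (2 * s ^ 2) ^ d * (c₁ * s) ^ (k - 1 - d) := by
    refine (card_nearCounts_le W (by positivity) hy₀ hL hΛ).trans ?_
    rw [hIcard]
    gcongr
    · rw [hs2]; linarith
    · rw [hc₁]
      nlinarith
  have hmain := card_mul_one_sub_errProb_le W hW hsum hM C G hδ hP
  -- The exponent of `s` is `2 * d + (k - 1 - d) - (k - 1) = d`.
  have hprod : (G.card : ℝ) * (c₂ / s) ^ (k - 1) ≤
      2 ^ d * c₁ ^ (k - 1 - d) * c₂ ^ (k - 1) * s ^ d := by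
    refine (mul_le_mul_of_nonneg_right hGcard (by positivity)).trans_eq ?_
    obtain ⟨e, he⟩ := Nat.exists_eq_add_of_le hdk
    rw [he, Nat.add_sub_cancel_left, div_pow, ← mul_div_assoc, div_eq_iff (by positivity)]
    ring_nf
  have hM0 : (0 : ℝ) ≤ M := Nat.cast_nonneg _
  have hfin : (M : ℝ) * (1 - ε) ≤
      2 * (2 ^ d * c₁ ^ (k - 1 - d) * c₂ ^ (k - 1) * s ^ d) := by
    have := mul_le_mul_of_nonneg_left (sub_le_sub_left hC 1) hM0
    linarith
  rw [← le_div_iff₀ h1ε] at hfin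
  exact hfin.trans_eq (by ring)

end Converse

/-! ### The achievability bound -/

section Achievability

variable {X Y : Type*}

lemma exists_word_symbolCount_eq [Fintype X] [DecidableEq X] {n : ℕ} (m : X → ℕ)
    (hm : ∑ x, m x = n) : ∃ v : Fin n → X, symbolCount v = m := by
  have e : Fin n ≃ Σ x, Fin (m x) := Fintype.equivOfCardEq (by simp [hm])
  refine ⟨fun i => (e i).1, ?_⟩
  funext x
  rw [symbolCount, ← Fintype.card_subtype]
  have e' : {i // (e i).1 = x} ≃ Fin (m x) :=
    (e.subtypeEquiv (q := fun s => s.1 = x) fun i => Iff.rfl).trans (Equiv.sigmaSubtype x)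
  simpa using Fintype.card_congr e'

variable [Fintype Y] [DecidableEq Y]

/-- A code in which each of the symbols of `I` occurs a multiple of `D` times, decoded by rounding
the dual statistics. -/
lemma exists_code_errProb_le [Fintype X] [DecidableEq X] (W : Matrix X Y ℝ)
    (hW : ∀ x y, 0 ≤ W x y) (hsum : ∀ x, ∑ y, W x y = 1) {I : Finset X} {x₀ : X} (hx₀ : x₀ ∉ I)
    {g : X → Y → ℝ} {G : ℝ} (hgG : ∀ x y, |g x y| ≤ G)
    (hg : ∀ x ∈ insert x₀ I, ∀ x' ∈ I, ∑ y, W x y * g x' y = if x = x' then 1 else 0)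
    {n D J : ℕ} (hD : 0 < D) (hJ : 0 < J) (hn : I.card * (J * D) ≤ n) :
    ∃ C : Code X Y n (J ^ I.card),
      errProb W C ≤ I.card * (n * (2 * G) ^ 2 / ((D : ℝ) / 2) ^ 2) := by
  classical
  set δ := n * (2 * G) ^ 2 / ((D : ℝ) / 2) ^ 2 with hδ
  have hD' : (0 : ℝ) < D := Nat.cast_pos.2 hD
  have hcard : Fintype.card (Fin (J ^ I.card)) = Fintype.card (I → Fin J) := by simp
  set e : Fin (J ^ I.card) ≃ (I → Fin J) := Fintype.equivOfCardEq hcard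
  have hword : ∀ u, ∃ v : Fin n → X, ∀ x : I,
      ∑ t, ∑ y, W (v t) y * g x y = (e u x : ℕ) * (D : ℝ) := by
    intro u
    set m₀ : X → ℕ := fun x => if h : x ∈ I then (e u ⟨x, h⟩ : ℕ) * D else 0 with hm₀
    have hle : ∑ x ∈ I, m₀ x ≤ n := by
      refine le_trans ?_ hn
      rw [← smul_eq_mul]
      refine Finset.sum_le_card_nsmul _ _ _ fun x hx => ?_
      simp only [hm₀, dif_pos hx]
      exact Nat.mul_le_mul_right _ (e u ⟨x, hx⟩).2.le
    -- The letter `x₀` pads the word to length `n`; by `hg` its row is orthogonal to every statistic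
    -- used.
    set m : X → ℕ := fun x => if x = x₀ then n - ∑ x ∈ I, m₀ x else m₀ x with hm
    have hm_out : ∀ x, x ∉ insert x₀ I → m x = 0 := by
      intro x hx
      rw [Finset.mem_insert, not_or] at hx
      simp [hm, hm₀, hx.1, hx.2]
    have hm_in : ∀ x ∈ I, m x = m₀ x := by
      intro x hx
      have : x ≠ x₀ := fun h => hx₀ (h ▸ hx)
      simp [hm, this]
    have hmsum : ∑ x, m x = n := by
      rw [← Finset.sum_subset (Finset.subset_univ (insert x₀ I)) fun x _ hx => hm_out x hx,
        Finset.sum_insert hx₀, Finset.sum_congr rfl hm_in]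
      simp only [hm, if_true]
      exact Nat.sub_add_cancel hle
    obtain ⟨v, hv⟩ := exists_word_symbolCount_eq m hmsum
    refine ⟨v, fun x => ?_⟩
    rw [sum_comp_eq_sum_symbolCount v (fun x' => ∑ y, W x' y * g x y), hv,
      Finset.sum_eq_single (x : X)]
    · rw [hg _ (Finset.mem_insert_of_mem x.2) _ x.2, if_pos rfl, mul_one, hm_in _ x.2]
      simp [hm₀]
    · intro x' _ hne
      by_cases hx' : x' ∈ insert x₀ I
      · rw [hg _ hx' _ x.2, if_neg hne, mul_zero]
      · rw [hm_out _ hx', Nat.cast_zero, zero_mul]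
    · simp
  choose enc henc using hword
  set near : Fin (J ^ I.card) → (Fin n → Y) → Prop := fun u y =>
    ∀ x : I, |∑ t, g x (y t) - (e u x : ℕ) * (D : ℝ)| < (D : ℝ) / 2 with hnear
  -- Two multiples of `D` at distance less than `D / 2` from the same number coincide.
  have huniq : ∀ u u' y, near u y → near u' y → u = u' := by
    intro u u' y h h'
    apply e.injective
    funext x
    have h1 := abs_lt.1 (h x)
    have h2 := abs_lt.1 (h' x)
    have h3 : ((e u x : ℕ) : ℝ) < (e u' x : ℕ) + 1 := by
      refine lt_of_mul_lt_mul_right (a := (D : ℝ)) ?_ hD'.le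
      linarith
    have h4 : ((e u' x : ℕ) : ℝ) < (e u x : ℕ) + 1 := by
      refine lt_of_mul_lt_mul_right (a := (D : ℝ)) ?_ hD'.le
      linarith
    have h3' : (e u x : ℕ) < (e u' x : ℕ) + 1 := by exact_mod_cast h3
    have h4' : (e u' x : ℕ) < (e u x : ℕ) + 1 := by exact_mod_cast h4
    exact Fin.ext (by omega)
  set C : Code X Y n (J ^ I.card) :=
    ⟨enc, fun y => if h : ∃ u, near u y then some h.choose else none⟩ with hC
  have hdec : ∀ u y, near u y → C.dec y = some u := by
    intro u y h
    have hex : ∃ u, near u y := ⟨u, h⟩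
    simp only [hC, dif_pos hex]
    rw [huniq _ _ y hex.choose_spec h]
  have herr : ∀ u, ∑ y, (if C.dec y ≠ some u then permLaw W (C.enc u) y else 0) ≤
      I.card * δ := by
    intro u
    set far : I → (Fin n → Y) → Prop := fun x y =>
      (D : ℝ) / 2 ≤ |∑ t, g x (y t) - ∑ t, ∑ y', W (enc u t) y' * g x y'| with hfar
    have hinv : ∀ (y : Fin n → Y) (σ : Equiv.Perm (Fin n)), (∃ x, far x (y ∘ σ)) = ∃ x, far x y := by
      intro y σ
      have : ∀ x : I, ∑ t, g x ((y ∘ σ) t) = ∑ t, g x (y t) := fun x =>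
        Equiv.sum_comp σ fun t => g x (y t)
      simp only [hfar, this]
    have h := sum_permLaw_mul W (enc u) (fun y => if ∃ x, far x y then 1 else 0)
      (fun y σ => by simp only [hinv])
    simp only [mul_ite, mul_one, mul_zero, ← Finset.sum_filter] at h
    calc _ ≤ ∑ y with ∃ x, far x y, permLaw W (enc u) y := by
          rw [← Finset.sum_filter]
          refine Finset.sum_le_sum_of_subset_of_nonneg (fun y hy => ?_)
            fun y _ _ => permLaw_nonneg W hW _ _
          rw [Finset.mem_filter] at hy ⊢
          refine ⟨hy.1, ?_⟩
          by_contra! hcon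
          refine hy.2 (hdec u y fun x => ?_)
          have := hcon x
          simp only [hfar, not_le, henc] at this
          exact this
      _ = ∑ z with ∃ x, far x z, dmcLaw W (enc u) z := h
      _ ≤ ∑ x, ∑ z with far x z, dmcLaw W (enc u) z :=
          sum_filter_exists_le _ fun z => dmcLaw_nonneg W hW _ _
      _ ≤ ∑ _x : I, δ := Finset.sum_le_sum fun x _ =>
          chebyshev_dmcLaw W hW hsum (enc u) (g x) (hgG x) (half_pos hD')
      _ = _ := by simp
  refine ⟨C, ?_⟩
  have hM : (0 : ℝ) < ((J ^ I.card : ℕ) : ℝ) := Nat.cast_pos.2 (pow_pos hJ _)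
  rw [errProb, div_le_iff₀ hM]
  refine (Finset.sum_le_sum fun u _ => herr u).trans_eq ?_
  rw [Finset.sum_const, Finset.card_univ, Fintype.card_fin, nsmul_eq_mul, mul_comm]

/-- For large blocklengths there are codes with at least a constant times `n ^ (d / 2)`
messages. -/
lemma exists_eventually_code_ge [Fintype X] [Nonempty X] (W : Matrix X Y ℝ)
    (hW : ∀ x y, 0 ≤ W x y) (hsum : ∀ x, ∑ y, W x y = 1) (hd : 1 ≤ affDim W) {ε : ℝ}
    (hε : 0 < ε) :
    ∃ c : ℝ, 0 < c ∧ ∀ᶠ n : ℕ in Filter.atTop, ∃ M : ℕ, 0 < M ∧ c * √n ^ affDim W ≤ M ∧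
      ∃ C : Code X Y n M, errProb W C ≤ ε := by
  classical
  obtain ⟨B, g, hBcard, hg⟩ := exists_row_basis_dual W
  rw [rank_eq_affDim_add_one W hsum] at hBcard
  obtain ⟨x₀, I, hx₀, hI, hIcard⟩ := Finset.card_eq_succ.1 hBcard
  set d := affDim W with hddef
  have hd0 : (0 : ℝ) < d := Nat.cast_pos.2 hd
  set G := ∑ x, ∑ y, |g x y| with hG
  have hgG : ∀ x y, |g x y| ≤ G := fun x y =>
    (Finset.single_le_sum (f := fun y => |g x y|) (fun _ _ => abs_nonneg _)
      (Finset.mem_univ y)).trans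
      (Finset.single_le_sum (f := fun x => ∑ y, |g x y|)
        (fun _ _ => Finset.sum_nonneg fun _ _ => abs_nonneg _) (Finset.mem_univ x))
  -- With `D ≥ β * √n` the error is at most `16 * d * G ^ 2 / β ^ 2 ≤ ε`; the `+ 1` keeps `β`
  -- positive even if `G = 0`.
  set β := √(16 * d * G ^ 2 / ε) + 1 with hβ
  have hβ0 : 0 < β := by positivity
  have hβ2 : 16 * d * G ^ 2 / ε ≤ β ^ 2 := by
    have h1 : √(16 * d * G ^ 2 / ε) ^ 2 = 16 * d * G ^ 2 / ε := Real.sq_sqrt (by positivity)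
    have h2 : 0 ≤ √(16 * d * G ^ 2 / ε) := Real.sqrt_nonneg _
    rw [hβ]
    nlinarith
  set q := d * (β + 1) with hq
  have hq0 : 0 < q := by positivity
  refine ⟨(1 / (2 * q)) ^ d, by positivity, ?_⟩
  -- From `s ≥ 2 * q` the loss from rounding down `J` is harmless: `s / q - 1 ≥ s / (2 * q)`.
  have hlarge : ∀ᶠ n : ℕ in Filter.atTop, 2 * q + 1 ≤ √(n : ℝ) :=
    (Real.tendsto_sqrt_atTop.comp tendsto_natCast_atTop_atTop).eventually_ge_atTop _
  filter_upwards [hlarge] with n hn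
  set s := √(n : ℝ) with hs
  have hs1 : 1 ≤ s := by linarith
  have hs0 : 0 < s := by linarith
  have hs2 : s ^ 2 = n := Real.sq_sqrt (Nat.cast_nonneg _)
  set D := ⌈β * s⌉₊ with hD
  have hDlow : β * s ≤ D := Nat.le_ceil _
  have hDup : (D : ℝ) ≤ (β + 1) * s := by
    have := (Nat.ceil_lt_add_one (a := β * s) (by positivity)).le
    rw [add_mul, one_mul]
    linarith
  have hDpos : 0 < D := Nat.ceil_pos.2 (by positivity)
  have hD0 : (0 : ℝ) < D := Nat.cast_pos.2 hDpos
  set J := n / (d * D) with hJ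
  have hJlow : 1 / (2 * q) * s ≤ J := by
    have h1 : (n : ℝ) < (J + 1) * (d * D) := by
      have := Nat.lt_div_mul_add (a := n) (b := d * D) (Nat.mul_pos hd hDpos)
      have h2 : n < (J + 1) * (d * D) := by rw [add_mul, one_mul]; exact this
      exact_mod_cast h2
    have h2 : (J + 1 : ℝ) * (d * D) ≤ (J + 1) * (q * s) := by
      have : (d : ℝ) * D ≤ q * s := by
        rw [hq, mul_assoc]
        gcongr
      gcongr
    have h3 : s < (J + 1) * q := by
      refine lt_of_mul_lt_mul_right (a := s) ?_ hs0.le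
      nlinarith
    rw [div_mul_eq_mul_div, one_mul, div_le_iff₀ (by positivity)]
    nlinarith
  have hJpos : 0 < J := by
    have : (0 : ℝ) < J := lt_of_lt_of_le (by positivity) hJlow
    exact_mod_cast this
  have hfit : I.card * (J * D) ≤ n := by
    rw [hIcard, mul_left_comm]
    exact Nat.div_mul_le_self _ _
  obtain ⟨C, hC⟩ := exists_code_errProb_le W hW hsum hx₀ hgG
    (fun x hx x' hx' => hg x (hI ▸ hx) x' (hI ▸ Finset.mem_insert_of_mem hx')) hDpos hJpos hfit
  refine ⟨J ^ I.card, pow_pos hJpos _, ?_, C, hC.trans ?_⟩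
  · rw [hIcard, ← mul_pow]
    push_cast
    gcongr
  · rw [hIcard, div_pow, div_div_eq_mul_div, ← mul_div_assoc, div_le_iff₀ (by positivity)]
    rw [div_le_iff₀ hε] at hβ2
    have h1 : (β * s) ^ 2 ≤ (D : ℝ) ^ 2 := pow_le_pow_left₀ (by positivity) hDlow 2
    rw [mul_pow, hs2] at h1
    calc (d : ℝ) * (n * (2 * G) ^ 2 * 2 ^ 2) = 16 * d * G ^ 2 * n := by ring
      _ ≤ β ^ 2 * ε * n := by gcongr
      _ = ε * (β ^ 2 * n) := by ring
      _ ≤ ε * (D : ℝ) ^ 2 := by gcongr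

end Achievability

/-! ### Asymptotics of the maximal code size -/

section Asymptotics

variable {X Y : Type*} [Fintype X] [Nonempty X] [Fintype Y] [DecidableEq Y]

/-- The maximal code size is of order `n ^ (d / 2)`. -/
lemma exists_eventually_maxMessages_bounds (W : Matrix X Y ℝ) (hpos : ∀ x y, 0 < W x y)
    (hsum : ∀ x, ∑ y, W x y = 1) (hd : 1 ≤ affDim W) {ε : ℝ} (hε0 : 0 < ε) (hε1 : ε < 1) :
    ∃ c K : ℝ, 0 < c ∧ 0 < K ∧ ∀ᶠ n : ℕ in Filter.atTop,
      c * √n ^ affDim W ≤ maxMessages W n ε ∧ (maxMessages W n ε : ℝ) ≤ K * √n ^ affDim W := by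
  obtain ⟨K, hK, hconv⟩ := exists_forall_code_le W hpos hsum hε1
  obtain ⟨c, hc, hach⟩ := exists_eventually_code_ge W (fun x y => (hpos x y).le) hsum hd hε0
  refine ⟨c, K, hc, hK, ?_⟩
  filter_upwards [hach, Filter.eventually_gt_atTop 0] with n ⟨M, hM0, hMc, hM⟩ hn
  set A := {M : ℕ | 0 < M ∧ ∃ C : Code X Y n M, errProb W C ≤ ε} with hA
  -- The converse bounds the admissible sizes, so `sSup` in `ℕ` is attained rather than taking its
  -- default value `0`.
  have hbdd : BddAbove A := by
    refine ⟨⌊K * √n ^ affDim W⌋₊, ?_⟩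
    rintro N ⟨hN0, C, hC⟩
    exact Nat.le_floor (hconv n hn N hN0 C hC)
  have hmem : maxMessages W n ε ∈ A := Nat.sSup_mem ⟨M, hM0, hM⟩ hbdd
  obtain ⟨hN0, C, hC⟩ := hmem
  refine ⟨hMc.trans (Nat.cast_le.2 (le_csSup hbdd ⟨hM0, hM⟩)), hconv n hn _ hN0 C hC⟩

/-- The logarithm of the maximal code size is `(d / 2) log n + O(1)`. -/
lemma exists_eventually_logb_maxMessages_bounds (W : Matrix X Y ℝ) (hpos : ∀ x y, 0 < W x y)
    (hsum : ∀ x, ∑ y, W x y = 1) (hd : 1 ≤ affDim W) {ε : ℝ} (hε0 : 0 < ε) (hε1 : ε < 1) :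
    ∃ a b : ℝ, ∀ᶠ n : ℕ in Filter.atTop,
      a + affDim W * Real.logb 2 √n ≤ Real.logb 2 (maxMessages W n ε) ∧
        Real.logb 2 (maxMessages W n ε) ≤ b + affDim W * Real.logb 2 √n := by
  obtain ⟨c, K, hc, hK, h⟩ := exists_eventually_maxMessages_bounds W hpos hsum hd hε0 hε1
  refine ⟨Real.logb 2 c, Real.logb 2 K, ?_⟩
  filter_upwards [h, Filter.eventually_gt_atTop 0] with n ⟨h1, h2⟩ hn
  have hs : 0 < √(n : ℝ) := Real.sqrt_pos.2 (Nat.cast_pos.2 hn)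
  have hlog : ∀ r : ℝ, 0 < r → Real.logb 2 (r * √n ^ affDim W) =
      Real.logb 2 r + affDim W * Real.logb 2 √n := by
    intro r hr
    rw [Real.logb_mul hr.ne' (by positivity), Real.logb_pow]
  rw [← hlog c hc, ← hlog K hK]
  have hpow : 0 < c * √(n : ℝ) ^ affDim W := by positivity
  exact ⟨Real.logb_le_logb_of_le one_lt_two hpow h1,
    Real.logb_le_logb_of_le one_lt_two (hpow.trans_le h1) h2⟩

/-- Since `log √n` is half of `log n`, both bounds divided by `log n` tend to `d / 2`; the liminf is
a limit. -/
lemma epsCapacity_eq (W : Matrix X Y ℝ) (hpos : ∀ x y, 0 < W x y)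
    (hsum : ∀ x, ∑ y, W x y = 1) (hd : 1 ≤ affDim W) {ε : ℝ} (hε0 : 0 < ε) (hε1 : ε < 1) :
    epsCapacity W ε = (((affDim W : ℝ) / 2 : ℝ) : EReal) := by
  obtain ⟨a, b, h⟩ := exists_eventually_logb_maxMessages_bounds W hpos hsum hd hε0 hε1
  have hlog : Filter.Tendsto (fun n : ℕ => Real.logb 2 n) Filter.atTop Filter.atTop :=
    (Real.tendsto_logb_atTop one_lt_two).comp tendsto_natCast_atTop_atTop
  have hlim : ∀ r : ℝ, Filter.Tendsto (fun n : ℕ => r / Real.logb 2 n + (affDim W : ℝ) / 2)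
      Filter.atTop (nhds ((affDim W : ℝ) / 2)) := by
    intro r
    simpa using (hlog.const_div_atTop r).add_const ((affDim W : ℝ) / 2)
  have hhalf : ∀ n : ℕ, Real.logb 2 √(n : ℝ) = Real.logb 2 n / 2 := by
    intro n
    rw [Real.logb, Real.log_sqrt (Nat.cast_nonneg n), Real.logb]
    ring
  have hquot : ∀ r l : ℝ, 0 < l → r / l + (affDim W : ℝ) / 2 = (r + affDim W * (l / 2)) / l := by
    intro r l hl
    field_simp
  have hpos' := hlog.eventually_gt_atTop 0
  have htend : Filter.Tendsto
      (fun n : ℕ => Real.logb 2 (maxMessages W n ε) / Real.logb 2 n) Filter.atTop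
      (nhds ((affDim W : ℝ) / 2)) := by
    refine tendsto_of_tendsto_of_tendsto_of_le_of_le' (hlim a) (hlim b) ?_ ?_
    · filter_upwards [h, hpos'] with n hn hl
      rw [hquot a _ hl, ← hhalf]
      exact div_le_div_of_nonneg_right hn.1 hl.le
    · filter_upwards [h, hpos'] with n hn hl
      rw [hquot b _ hl, ← hhalf]
      exact div_le_div_of_nonneg_right hn.2 hl.le
  exact ((continuous_coe_real_ereal.tendsto _).comp htend).liminf_eq

end Asymptotics

end NoisyPerm

end

theorem mainTheorem1 {X Y : Type*} [Fintype X] [Nonempty X] [Fintype Y] [DecidableEq Y]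
    (W : Matrix X Y ℝ) (hpos : ∀ x y, 0 < W x y) (hsum : ∀ x, ∑ y, W x y = 1)
    (hd : 1 ≤ NoisyPerm.affDim W) (ε : ℝ) (hε0 : 0 < ε) (hε1 : ε < 1) :
    (∀ S : Affine.Simplex ℝ (EuclideanSpace ℝ Y) (NoisyPerm.affDim W),
      NoisyPerm.IsMinReference W S →
      0 < NoisyPerm.gaussianCoeff S ε → NoisyPerm.gaussianCoeff S ε < ⊤ →
      ∃ C : ℝ, ∀ᶠ n : ℕ in Filter.atTop,
        Real.logb 2 (NoisyPerm.maxMessages W n ε) ≤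
          (NoisyPerm.affDim W : ℝ) *
              Real.logb 2 ((NoisyPerm.gaussianCoeff S ε).toReal * Real.sqrt n) +
            Real.logb 2 (NoisyPerm.volRatio W) + C) ∧
    NoisyPerm.epsCapacity W ε = (((NoisyPerm.affDim W : ℝ) / 2 : ℝ) : EReal) ∧
    W.rank = NoisyPerm.affDim W + 1 := by
  refine ⟨fun S _ hc0 hctop => ?_,
    NoisyPerm.epsCapacity_eq W hpos hsum hd hε0 hε1, NoisyPerm.rank_eq_affDim_add_one W hsum⟩
  obtain ⟨a, b, h⟩ :=
    NoisyPerm.exists_eventually_logb_maxMessages_bounds W hpos hsum hd hε0 hε1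
  have hc : 0 < (NoisyPerm.gaussianCoeff S ε).toReal := ENNReal.toReal_pos hc0.ne' hctop.ne
  -- The constant cancels the `gaussianCoeff` and `volRatio` terms, leaving the upper bound `b + d
  -- log √n`.
  refine ⟨b - NoisyPerm.affDim W * Real.logb 2 (NoisyPerm.gaussianCoeff S ε).toReal -
    Real.logb 2 (NoisyPerm.volRatio W), ?_⟩
  filter_upwards [h, Filter.eventually_gt_atTop 0] with n hn hn0
  have hs : 0 < √(n : ℝ) := Real.sqrt_pos.2 (Nat.cast_pos.2 hn0)
  rw [Real.logb_mul hc.ne' hs.ne']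
  linarith [hn.2]
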